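/- A plane binary tree is a rooted tree in which every vertex either has no children (a leaf) or has an ordered pair of children. A tanglegram of size $n$ is a triple consisting of two plane binary trees $B_1, B_2$ with $n$ leaves each and a perfect matching between the leaves of $B_1$ and the leaves of $B_2$, considered up to isomorphism: two triples represent the same tanglegram if there are graph isomorphisms between the two left trees and between the two right trees that map roots to roots and are compatible with the matchings. An automorphism of a tanglegram is an isomorphism (a pair of tree isomorphisms, as above) from a triple representing it to itself. A cherry is a pair of distinct leaves with a common parent. A matched cherry is a cherry of the left tree whose two leaves are matched to the two leaves of a cherry of the right tree. An automorphism is induced by matched cherries if, for some set $C$ of matched cherries, it interchanges the two leaves of every cherry in $C$ (and, on the right, the leaves matched to them) and fixes all other leaves. **Theorem.** Choose a tanglegram of size $n$ uniformly at random. 1. For every integer $k \ge 0$, the probability that there are exactly $k$ matched cherries converges to $\dfrac{e^{-1/4}4^{-k}}{k!}$ as $n \to \infty$; that is, the number of matched cherries has a limiting Poisson distribution with mean $\frac14$. 2. For every integer $k \ge 0$, the probability that there are exactly $k$ matched cherries and no automorphisms other than the $2^k$ automorphisms induced by them converges to the same limit $\dfrac{e^{-1/4}4^{-k}}{k!}$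 as $n \to \infty$. 3. The probability that all automorphisms are induced by matched cherries converges to $1$ as $n \to \infty$. -/

import Mathlib

namespace RandomTanglegram

/-- Vertices of a plane binary tree. `BinaryTree.nil` is the tree that consists of a single leaf,
and `BinaryTree.node _ l r` is a root with left branch `l` and right branch `r` (this is the
convention of `BinaryTree.numLeaves`). -/
inductive Vert : BinaryTree Unit → Type
  | root (t : BinaryTree Unit) : Vert t
  | inl {a : Unit} {l r : BinaryTree Unit} (v : Vert l) : Vert (BinaryTree.node a l r)
  | inr {a : Unit} {l r : BinaryTree Unit} (v : Vert r) : Vert (BinaryTree.node a l r)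

/-- `Child u v`: the vertex `v` is a child of the vertex `u`. -/
inductive Child : {t : BinaryTree Unit} → Vert t → Vert t → Prop
  | left (a : Unit) (l r : BinaryTree Unit) :
      Child (Vert.root (BinaryTree.node a l r)) (Vert.inl (Vert.root l))
  | right (a : Unit) (l r : BinaryTree Unit) :
      Child (Vert.root (BinaryTree.node a l r)) (Vert.inr (Vert.root r))
  | inl {a : Unit} {l r : BinaryTree Unit} {u v : Vert l} (h : Child u v) :
      Child (Vert.inl (a := a) (r := r) u) (Vert.inl v)
  | inr {a : Unit} {l r : BinaryTree Unit} {u v : Vert r} (h : Child u v) :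
      Child (Vert.inr (a := a) (l := l) u) (Vert.inr v)

/-- The underlying graph of a plane binary tree. -/
def treeGraph (t : BinaryTree Unit) : SimpleGraph (Vert t) := SimpleGraph.fromRel Child

/-- A leaf is a vertex without children. -/
def Leaf (t : BinaryTree Unit) : Type := {v : Vert t // ∀ w, ¬ Child v w}

/-- Isomorphisms of the underlying graphs that map the root to the root. -/
def RootedIso (s t : BinaryTree Unit) : Type :=
  {e : treeGraph s ≃g treeGraph t // e (Vert.root s) = Vert.root t}

section BasicFacts

/-- The distance of a vertex from the root. -/
def Vert.depth : {t : BinaryTree Unit} → Vert t → ℕ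
  | _, .root _ => 0
  | _, .inl v => v.depth + 1
  | _, .inr v => v.depth + 1

theorem Child.depth_eq {t : BinaryTree Unit} {u v : Vert t} (h : Child u v) :
    v.depth = u.depth + 1 := by
  induction h with
  | left => rfl
  | right => rfl
  | inl _ ih => simp [Vert.depth, ih]
  | inr _ ih => simp [Vert.depth, ih]

theorem exists_parent {t : BinaryTree Unit} (v : Vert t) (hv : v ≠ Vert.root t) :
    ∃ p, Child p v := by
  induction v with
  | root t => exact absurd rfl hv
  | @inl a l r w ih =>
    by_cases hw : w = Vert.root l
    · subst hw
      exact ⟨_, Child.left a l r⟩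
    · obtain ⟨p, hp⟩ := ih hw
      exact ⟨_, Child.inl hp⟩
  | @inr a l r w ih =>
    by_cases hw : w = Vert.root r
    · subst hw
      exact ⟨_, Child.right a l r⟩
    · obtain ⟨p, hp⟩ := ih hw
      exact ⟨_, Child.inr hp⟩

theorem not_child_root {t : BinaryTree Unit} (u : Vert t) : ¬ Child u (Vert.root t) := by
  intro h
  have := h.depth_eq
  simp [Vert.depth] at this

theorem Child.parent_unique {t : BinaryTree Unit} {u u' v : Vert t} (h : Child u v)
    (h' : Child u' v) : u = u' := by
  induction h with
  | left a l r =>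
    cases h' with
    | left => rfl
    | inl h => exact absurd h (not_child_root _)
  | right a l r =>
    cases h' with
    | right => rfl
    | inr h => exact absurd h (not_child_root _)
  | inl h ih =>
    cases h' with
    | left => exact absurd h (not_child_root _)
    | inl h2 => rw [ih h2]
  | inr h ih =>
    cases h' with
    | right => exact absurd h (not_child_root _)
    | inr h2 => rw [ih h2]

theorem treeGraph_adj {t : BinaryTree Unit} {u v : Vert t} :
    (treeGraph t).Adj u v ↔ Child u v ∨ Child v u := by
  simp only [treeGraph, SimpleGraph.fromRel_adj, and_iff_right_iff_imp]
  rintro (h | h) rfl <;> · have := h.depth_eq; omega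

theorem RootedIso.map_child {s t : BinaryTree Unit} (e : RootedIso s t) {u v : Vert s}
    (h : Child u v) : Child (e.1 u) (e.1 v) := by
  induction hd : u.depth generalizing u v with
  | zero =>
    have hu : u = Vert.root s := by
      by_contra hu
      obtain ⟨p, hp⟩ := exists_parent u hu
      have := hp.depth_eq
      omega
    subst hu
    rcases treeGraph_adj.1 (e.1.map_adj_iff.2 (treeGraph_adj.2 (Or.inl h))) with h1 | h1
    · exact h1
    · rw [e.2] at h1
      exact absurd h1 (not_child_root _)
  | succ d ih =>
    rcases treeGraph_adj.1 (e.1.map_adj_iff.2 (treeGraph_adj.2 (Or.inl h))) with h1 | h1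
    · exact h1
    · obtain ⟨p, hp⟩ := exists_parent u (by rintro rfl; simp [Vert.depth] at hd)
      have hpd := hp.depth_eq
      have h2 := h1.parent_unique (ih hp (by omega))
      have h3 : v = p := e.1.injective h2
      have := h.depth_eq
      subst h3
      omega

end BasicFacts

/-- The identity isomorphism. -/
def RootedIso.refl (t : BinaryTree Unit) : RootedIso t t := ⟨SimpleGraph.Iso.refl, rfl⟩

/-- The inverse isomorphism. -/
def RootedIso.symm {s t : BinaryTree Unit} (e : RootedIso s t) : RootedIso t s :=
  ⟨SimpleGraph.Iso.symm e.1, e.1.toEquiv.symm_apply_eq.2 e.2.symm⟩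

/-- Composition of isomorphisms: first `e`, then `f`. -/
def RootedIso.trans {s t u : BinaryTree Unit} (e : RootedIso s t) (f : RootedIso t u) :
    RootedIso s u :=
  ⟨e.1.trans f.1, by
    change f.1 (e.1 _) = _
    rw [e.2, f.2]⟩

theorem RootedIso.ext {s t : BinaryTree Unit} {e f : RootedIso s t} (h : ∀ v, e.1 v = f.1 v) :
    e = f := Subtype.ext (RelIso.ext h)

theorem RootedIso.child_iff {s t : BinaryTree Unit} (e : RootedIso s t) {u v : Vert s} :
    Child (e.1 u) (e.1 v) ↔ Child u v := by
  refine ⟨fun h => ?_, e.map_child⟩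
  have h2 := e.symm.map_child h
  have h3 : ∀ x, e.symm.1 (e.1 x) = x := fun x => e.1.symm_apply_apply x
  rwa [h3, h3] at h2

/-- The bijection between the leaves induced by an isomorphism. -/
def RootedIso.leafEquiv {s t : BinaryTree Unit} (e : RootedIso s t) : Leaf s ≃ Leaf t :=
  e.1.toEquiv.subtypeEquiv fun v => by
    constructor
    · intro h w hw
      obtain ⟨w, rfl⟩ := e.1.surjective w
      exact h w (e.child_iff.1 hw)
    · intro h w hw
      exact h _ (e.child_iff.2 hw)

/-- The set of cherries: unordered pairs of distinct leaves with a common parent. -/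
def cherries (t : BinaryTree Unit) : Set (Sym2 (Leaf t)) :=
  {c | ∃ x y : Leaf t, x ≠ y ∧ (∃ p : Vert t, Child p x.1 ∧ Child p y.1) ∧ c = s(x, y)}

theorem RootedIso.map_mem_cherries {s t : BinaryTree Unit} (e : RootedIso s t)
    {c : Sym2 (Leaf s)} (hc : c ∈ cherries s) : c.map e.leafEquiv ∈ cherries t := by
  obtain ⟨x, y, hxy, ⟨p, hx, hy⟩, rfl⟩ := hc
  exact ⟨_, _, fun h => hxy (e.leafEquiv.injective h),
    ⟨e.1 p, e.map_child hx, e.map_child hy⟩, rfl⟩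

/-- A representative of a tanglegram of size `n`: two plane binary trees with `n` leaves each and a
perfect matching between the leaves of the left tree and the leaves of the right tree. -/
structure Rep (n : ℕ) : Type where
  left : BinaryTree Unit
  right : BinaryTree Unit
  left_size : left.numLeaves = n
  right_size : right.numLeaves = n
  matching : Leaf left ≃ Leaf right

/-- Isomorphisms of (representatives of) tanglegrams: isomorphisms of the left trees and of the
right trees, fixing the roots, that are compatible with the matchings. -/
structure Iso {n : ℕ} (X Y : Rep n) : Type where
  left : RootedIso X.left Y.left
  right : RootedIso X.right Y.right
  matching : ∀ x : Leaf X.left, right.leafEquiv (X.matching x) = Y.matching (left.leafEquiv x)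

/-- The identity isomorphism. -/
def Iso.refl {n : ℕ} (X : Rep n) : Iso X X := ⟨RootedIso.refl _, RootedIso.refl _, fun _ => rfl⟩

/-- The inverse isomorphism. -/
def Iso.symm {n : ℕ} {X Y : Rep n} (f : Iso X Y) : Iso Y X :=
  ⟨f.left.symm, f.right.symm, fun x => by
    have h := f.matching (f.left.leafEquiv.symm x)
    rw [Equiv.apply_symm_apply] at h
    change f.right.leafEquiv.symm _ = X.matching (f.left.leafEquiv.symm x)
    rw [← h, Equiv.symm_apply_apply]⟩

/-- Composition of isomorphisms: first `f`, then `g`. -/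
def Iso.trans {n : ℕ} {X Y Z : Rep n} (f : Iso X Y) (g : Iso Y Z) : Iso X Z :=
  ⟨f.left.trans g.left, f.right.trans g.right, fun x => by
    have h := g.matching (f.left.leafEquiv x)
    rw [← f.matching] at h
    exact h⟩

theorem Iso.ext {n : ℕ} {X Y : Rep n} {f g : Iso X Y} (hl : ∀ v, f.left.1 v = g.left.1 v)
    (hr : ∀ v, f.right.1 v = g.right.1 v) : f = g := by
  obtain ⟨fl, fr, _⟩ := f
  obtain ⟨gl, gr, _⟩ := g
  obtain rfl : fl = gl := RootedIso.ext hl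
  obtain rfl : fr = gr := RootedIso.ext hr
  rfl

instance repSetoid (n : ℕ) : Setoid (Rep n) where
  r X Y := Nonempty (Iso X Y)
  iseqv := ⟨fun X => ⟨Iso.refl X⟩, fun ⟨f⟩ => ⟨f.symm⟩, fun ⟨f⟩ ⟨g⟩ => ⟨f.trans g⟩⟩

/-- Tanglegrams of size `n`. -/
def Tanglegram (n : ℕ) : Type := Quotient (repSetoid n)

namespace Rep

variable {n : ℕ} (X : Rep n)

/-- The matched cherries: cherries of the left tree whose two leaves are matched to the two leaves
of a cherry of the right tree. -/
def matchedCherries : Set (Sym2 (Leaf X.left)) :=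
  {c | c ∈ cherries X.left ∧ c.map X.matching ∈ cherries X.right}

/-- The number of matched cherries. -/
noncomputable def numMatchedCherries : ℕ := X.matchedCherries.ncard

/-- The number of automorphisms. -/
noncomputable def numAut : ℕ := Nat.card (Iso X X)

/-- The automorphism `f` is induced by matched cherries: there is a set of matched cherries such
that `f` interchanges the two leaves of each of them and fixes all other leaves. (It is enough to
say this for the leaves on the left: the leaf matched with `x` is sent to the leaf matched with
the image of `x`.) -/
def IsInduced (f : Iso X X) : Prop :=
  ∃ C ⊆ X.matchedCherries, ∀ x : Leaf X.left,
    (∀ y, s(x, y) ∈ C → f.left.leafEquiv x = y) ∧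
    ((∀ c ∈ C, x ∉ c) → f.left.leafEquiv x = x)

/-- All automorphisms are induced by matched cherries. -/
def AllAutInduced : Prop := ∀ f : Iso X X, X.IsInduced f

variable {X} {Y : Rep n}

theorem map_mem_matchedCherries (f : Iso X Y) {c : Sym2 (Leaf X.left)}
    (hc : c ∈ X.matchedCherries) : c.map f.left.leafEquiv ∈ Y.matchedCherries := by
  refine ⟨f.left.map_mem_cherries hc.1, ?_⟩
  have h := f.right.map_mem_cherries hc.2
  rw [Sym2.map_map] at h ⊢
  have hf : (Y.matching ∘ f.left.leafEquiv : Leaf X.left → Leaf Y.right) =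
      f.right.leafEquiv ∘ X.matching := funext fun x => (f.matching x).symm
  rwa [hf]

theorem numMatchedCherries_eq (f : Iso X Y) : X.numMatchedCherries = Y.numMatchedCherries := by
  refine Set.ncard_congr (fun c _ => c.map f.left.leafEquiv)
    (fun c hc => map_mem_matchedCherries f hc)
    (fun _ _ _ _ h => Sym2.map.injective f.left.leafEquiv.injective h) fun d hd => ?_
  refine ⟨d.map f.left.leafEquiv.symm, map_mem_matchedCherries f.symm hd, ?_⟩
  simp [Sym2.map_map]

theorem numAut_eq (f : Iso X Y) : X.numAut = Y.numAut := by
  refine Nat.card_congr ⟨fun g => (f.symm.trans g).trans f, fun g => (f.trans g).trans f.symm,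
    fun g => Iso.ext (fun v => ?_) fun v => ?_, fun g => Iso.ext (fun v => ?_) fun v => ?_⟩
  · exact (f.left.1.symm_apply_apply _).trans (congrArg g.left.1 (f.left.1.symm_apply_apply _))
  · exact (f.right.1.symm_apply_apply _).trans (congrArg g.right.1 (f.right.1.symm_apply_apply _))
  · exact (f.left.1.apply_symm_apply _).trans (congrArg g.left.1 (f.left.1.apply_symm_apply _))
  · exact (f.right.1.apply_symm_apply _).trans (congrArg g.right.1 (f.right.1.apply_symm_apply _))

theorem AllAutInduced.of_iso (f : Iso X Y) (h : X.AllAutInduced) : Y.AllAutInduced := by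
  intro g
  obtain ⟨C, hC, hx⟩ := h ((f.trans g).trans f.symm)
  have key : ∀ x, g.left.leafEquiv (f.left.leafEquiv x) =
      f.left.leafEquiv (((f.trans g).trans f.symm).left.leafEquiv x) := fun x =>
    (f.left.leafEquiv.apply_symm_apply _).symm
  refine ⟨Sym2.map f.left.leafEquiv '' C, ?_, fun y => ?_⟩
  · rintro _ ⟨c, hc, rfl⟩
    exact map_mem_matchedCherries f (hC hc)
  · obtain ⟨x, rfl⟩ := f.left.leafEquiv.surjective y
    rw [key]
    constructor
    · rintro z hz
      obtain ⟨z, rfl⟩ := f.left.leafEquiv.surjective z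
      rw [← Sym2.map_mk,
        (Sym2.map.injective f.left.leafEquiv.injective).mem_set_image] at hz
      rw [(hx x).1 z hz]
    · intro hz
      rw [(hx x).2 fun c hc hxc => hz _ ⟨c, hc, rfl⟩ (Sym2.mem_map.2 ⟨x, hxc, rfl⟩)]

end Rep

namespace Tanglegram

variable {n : ℕ}

/-- The number of matched cherries of a tanglegram. -/
noncomputable def numMatchedCherries (T : Tanglegram n) : ℕ :=
  Quotient.lift (s := repSetoid n) Rep.numMatchedCherries
    (fun X Y (h : Nonempty (Iso X Y)) => h.elim Rep.numMatchedCherries_eq) T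

/-- The order of the automorphism group of a tanglegram. -/
noncomputable def numAut (T : Tanglegram n) : ℕ :=
  Quotient.lift (s := repSetoid n) Rep.numAut
    (fun X Y (h : Nonempty (Iso X Y)) => h.elim Rep.numAut_eq) T

/-- All automorphisms of the tanglegram are induced by matched cherries. -/
def AllAutInduced (T : Tanglegram n) : Prop :=
  Quotient.lift (s := repSetoid n) Rep.AllAutInduced
    (fun X Y (h : Nonempty (Iso X Y)) => h.elim fun f =>
      propext ⟨Rep.AllAutInduced.of_iso f, Rep.AllAutInduced.of_iso f.symm⟩) T

end Tanglegram

/-- The probability that a uniformly random tanglegram of size `n` has the property `E`. -/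
noncomputable def prob (n : ℕ) (E : Tanglegram n → Prop) : ℝ :=
  (Nat.card {T : Tanglegram n // E T} : ℝ) / (Nat.card (Tanglegram n) : ℝ)

end RandomTanglegram

/-! The class of a representative `X` contains `4 ^ (n - 1) / X.numAut` representatives: each
internal vertex of the two trees offers a choice whether to exchange its branches, and automorphisms
account for the repetitions (`card_class_mul_numAut`). A uniform tanglegram is therefore a uniform
representative biased by the order of its automorphism group (`card_tanglegram`, `prob_eq`).

Let `M` be the number of matched cherries. The induced automorphisms correspond to the sets of
matched cherries, so `numAut` is `2 ^ M` plus the number of automorphisms that are not induced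
(`Rep.numAut_eq_add`). The average of the second term is `O(1 / n)` (`sum_card_not_induced_le`). For
this, triples of two tree automorphisms and a compatible matching are counted. Compatibility makes
the two leaf permutations conjugate, so both move the same number `2 * j` of leaves, and the number
of matchings is the order of a centralizer. The weighted count `TreeIso.sum_weight_le` bounds the
tree automorphisms; one that does more than interchange cherries exchanges branches at fewer than
`j` topmost places, which gains a factor `j / n`.

Under the uniform measure on representatives `M` tends to a Poisson variable with mean `1 / 8`. The
average of `M.choose j` again counts triples, now with involutions made of `j` cherry interchanges.
It involves the number of choices of `j` cherries in all trees, `catalan (n - j) * (n + 1 -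
j).choose j` for size `n + 1`, found from a quadratic functional equation (`numCherryAut_eq`). These
moments converge (`tendsto_moment`) and are dominated by `expBase ^ j / j!`, so averages of binomial
series in `M` converge termwise (`tendsto_average`).

Biasing by `2 ^ M` turns mean `1 / 8` into mean `1 / 4`. The representatives with an automorphism
that is not induced have negligible biased mass, since composition shows that at least half of their
automorphisms are not induced (`autMass_le`). This gives the last two claims. -/

namespace RandomTanglegram

open BinaryTree

/-! ### Vertices and leaves of a tree in terms of its branches -/

theorem child_inl_iff {a : Unit} {l r : BinaryTree Unit} {u : Vert l} {w : Vert (node a l r)} :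
    Child (Vert.inl u) w ↔ ∃ v, w = Vert.inl v ∧ Child u v := by
  constructor
  · intro h
    cases h with
    | inl h => exact ⟨_, rfl, h⟩
  · rintro ⟨v, rfl, h⟩
    exact .inl h

theorem child_inr_iff {a : Unit} {l r : BinaryTree Unit} {u : Vert r} {w : Vert (node a l r)} :
    Child (Vert.inr u) w ↔ ∃ v, w = Vert.inr v ∧ Child u v := by
  constructor
  · intro h
    cases h with
    | inr h => exact ⟨_, rfl, h⟩
  · rintro ⟨v, rfl, h⟩
    exact .inr h

theorem child_root_iff {a : Unit} {l r : BinaryTree Unit} {w : Vert (node a l r)} :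
    Child (Vert.root _) w ↔ w = Vert.inl (Vert.root l) ∨ w = Vert.inr (Vert.root r) := by
  constructor
  · intro h
    cases h with
    | left => exact .inl rfl
    | right => exact .inr rfl
  · rintro (rfl | rfl)
    · exact .left _ _ _
    · exact .right _ _ _

theorem not_child_nil (u v : Vert (nil : BinaryTree Unit)) : ¬ Child u v := by
  intro h
  cases h

/-- The only leaf of the tree that consists of a single leaf. -/
def Leaf.single : Leaf nil := ⟨Vert.root _, fun _ => not_child_nil _ _⟩

/-- A leaf of the left branch, as a leaf of the whole tree. -/
def Leaf.inl {a : Unit} {l r : BinaryTree Unit} (x : Leaf l) : Leaf (node a l r) :=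
  ⟨.inl x.1, fun w h => by
    obtain ⟨v, -, h⟩ := child_inl_iff.1 h
    exact x.2 v h⟩

/-- A leaf of the right branch, as a leaf of the whole tree. -/
def Leaf.inr {a : Unit} {l r : BinaryTree Unit} (x : Leaf r) : Leaf (node a l r) :=
  ⟨.inr x.1, fun w h => by
    obtain ⟨v, -, h⟩ := child_inr_iff.1 h
    exact x.2 v h⟩

theorem Leaf.eq_single (x : Leaf nil) : x = Leaf.single := by
  obtain ⟨v, hv⟩ := x
  cases v
  rfl

theorem Leaf.inl_or_inr {a : Unit} {l r : BinaryTree Unit} (x : Leaf (node a l r)) :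
    (∃ y, x = Leaf.inl y) ∨ ∃ y, x = Leaf.inr y := by
  obtain ⟨v, hv⟩ := x
  cases v with
  | root => exact absurd (Child.left _ _ _) (hv _)
  | inl v => exact .inl ⟨⟨v, fun w h => hv _ (.inl h)⟩, rfl⟩
  | inr v => exact .inr ⟨⟨v, fun w h => hv _ (.inr h)⟩, rfl⟩

theorem Leaf.inl_injective {a : Unit} {l r : BinaryTree Unit} :
    Function.Injective (Leaf.inl (a := a) (l := l) (r := r)) := by
  rintro ⟨x, _⟩ ⟨y, _⟩ h
  have := congrArg Subtype.val h
  simp only [Leaf.inl] at this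
  cases this
  rfl

theorem Leaf.inr_injective {a : Unit} {l r : BinaryTree Unit} :
    Function.Injective (Leaf.inr (a := a) (l := l) (r := r)) := by
  rintro ⟨x, _⟩ ⟨y, _⟩ h
  have := congrArg Subtype.val h
  simp only [Leaf.inr] at this
  cases this
  rfl

@[simp] theorem Leaf.inl_inj {a : Unit} {l r : BinaryTree Unit} {x y : Leaf l} :
    (Leaf.inl x : Leaf (node a l r)) = Leaf.inl y ↔ x = y := Leaf.inl_injective.eq_iff

@[simp] theorem Leaf.inr_inj {a : Unit} {l r : BinaryTree Unit} {x y : Leaf r} :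
    (Leaf.inr x : Leaf (node a l r)) = Leaf.inr y ↔ x = y := Leaf.inr_injective.eq_iff

@[simp] theorem Leaf.inl_ne_inr {a : Unit} {l r : BinaryTree Unit} (x : Leaf l) (y : Leaf r) :
    (Leaf.inl x : Leaf (node a l r)) ≠ Leaf.inr y := by
  intro h
  have := congrArg Subtype.val h
  simp only [Leaf.inl, Leaf.inr] at this
  cases this

@[simp] theorem Leaf.inr_ne_inl {a : Unit} {l r : BinaryTree Unit} (x : Leaf r) (y : Leaf l) :
    (Leaf.inr x : Leaf (node a l r)) ≠ Leaf.inl y := (Leaf.inl_ne_inr y x).symm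

/-- The leaves of a tree are those of its two branches. -/
noncomputable def leafNodeEquiv (a : Unit) (l r : BinaryTree Unit) :
    Leaf l ⊕ Leaf r ≃ Leaf (node a l r) :=
  Equiv.ofBijective (Sum.elim Leaf.inl Leaf.inr) <| by
    constructor
    · rintro (x | x) (y | y) h <;> simp_all
    · intro x
      obtain ⟨y, rfl⟩ | ⟨y, rfl⟩ := x.inl_or_inr
      · exact ⟨.inl y, rfl⟩
      · exact ⟨.inr y, rfl⟩

@[simp] theorem leafNodeEquiv_inl (a : Unit) {l r : BinaryTree Unit} (x : Leaf l) :
    leafNodeEquiv a l r (.inl x) = Leaf.inl x := rfl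

@[simp] theorem leafNodeEquiv_inr (a : Unit) {l r : BinaryTree Unit} (x : Leaf r) :
    leafNodeEquiv a l r (.inr x) = Leaf.inr x := rfl

instance : Unique (Leaf nil) := ⟨⟨Leaf.single⟩, Leaf.eq_single⟩

instance finite_leaf (t : BinaryTree Unit) : Finite (Leaf t) := by
  induction t with
  | nil => infer_instance
  | node a l r _ _ => exact Finite.of_equiv _ (leafNodeEquiv a l r)

noncomputable instance (t : BinaryTree Unit) : Fintype (Leaf t) := Fintype.ofFinite _

theorem card_leaf (t : BinaryTree Unit) : Fintype.card (Leaf t) = t.numLeaves := by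
  rw [← Nat.card_eq_fintype_card]
  induction t with
  | nil => simp
  | node a l r hl hr =>
    rw [← Nat.card_congr (leafNodeEquiv a l r), Nat.card_sum, hl, hr, BinaryTree.numLeaves]

/-- A bijection that preserves the root and the children is an isomorphism. -/
def RootedIso.ofChild {s t : BinaryTree Unit} (e : Vert s ≃ Vert t)
    (h : ∀ u v, Child u v → Child (e u) (e v))
    (h' : ∀ u v, Child u v → Child (e.symm u) (e.symm v))
    (hr : e (Vert.root s) = Vert.root t) : RootedIso s t :=
  ⟨⟨e, fun {u v} => by
    have h'' : ∀ u v, Child (e u) (e v) → Child u v := fun u v huv => by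
      simpa using h' _ _ huv
    rw [treeGraph_adj, treeGraph_adj]
    exact or_congr ⟨h'' _ _, h _ _⟩ ⟨h'' _ _, h _ _⟩⟩, hr⟩

/-! ### Rooted isomorphisms in terms of isomorphisms of the branches -/

section Join

variable {a b : Unit} {l r l' r' : BinaryTree Unit}

/-- Extend maps between branches to a map between trees. -/
def Vert.map (f : Vert l → Vert l') (g : Vert r → Vert r') :
    Vert (node a l r) → Vert (node b l' r')
  | .root _ => .root _
  | .inl v => .inl (f v)
  | .inr v => .inr (g v)

/-- Exchange the two branches. -/
def Vert.flip : Vert (node a l r) → Vert (node b r l)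
  | .root _ => .root _
  | .inl v => .inr v
  | .inr v => .inl v

/-- Join isomorphisms between the left branches and between the right branches. -/
def RootedIso.keep (e : RootedIso l l') (f : RootedIso r r') :
    RootedIso (node a l r) (node b l' r') :=
  .ofChild
    ⟨Vert.map e.1 f.1, Vert.map e.symm.1 f.symm.1, by
      rintro (_ | v | v)
      · rfl
      · exact congrArg Vert.inl (e.1.symm_apply_apply v)
      · exact congrArg Vert.inr (f.1.symm_apply_apply v), by
      rintro (_ | v | v)
      · rfl
      · exact congrArg Vert.inl (e.1.apply_symm_apply v)
      · exact congrArg Vert.inr (f.1.apply_symm_apply v)⟩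
    (by
      intro u v h
      cases h with
      | left => exact child_root_iff.2 (.inl (congrArg Vert.inl e.2))
      | right => exact child_root_iff.2 (.inr (congrArg Vert.inr f.2))
      | inl h => exact .inl (e.map_child h)
      | inr h => exact .inr (f.map_child h))
    (by
      intro u v h
      cases h with
      | left => exact child_root_iff.2 (.inl (congrArg Vert.inl e.symm.2))
      | right => exact child_root_iff.2 (.inr (congrArg Vert.inr f.symm.2))
      | inl h => exact .inl (e.symm.map_child h)
      | inr h => exact .inr (f.symm.map_child h)) rfl

/-- The isomorphism that exchanges the two branches. -/
def RootedIso.flip (a b : Unit) (l r : BinaryTree Unit) : RootedIso (node a l r) (node b r l) :=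
  .ofChild
    ⟨Vert.flip, Vert.flip, by rintro (_ | v | v) <;> rfl, by rintro (_ | v | v) <;> rfl⟩
    (by
      intro u v h
      cases h with
      | left => exact .right _ _ _
      | right => exact .left _ _ _
      | inl h => exact .inr h
      | inr h => exact .inl h)
    (by
      intro u v h
      cases h with
      | left => exact .right _ _ _
      | right => exact .left _ _ _
      | inl h => exact .inr h
      | inr h => exact .inl h) rfl

/-- Children go to children, so the image of a vertex lies in the same branch as the image of its
parent; hence the induction on the depth. -/
theorem RootedIso.map_inl {e : RootedIso (node a l r) (node b l' r')}
    (h : e.1 (.inl (.root l)) = .inl (.root l')) (v : Vert l) : ∃ w, e.1 (.inl v) = .inl w := by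
  induction hd : v.depth generalizing v with
  | zero =>
    have : v = .root l := by
      by_contra hv
      obtain ⟨p, hp⟩ := exists_parent v hv
      have := hp.depth_eq
      omega
    exact ⟨_, this ▸ h⟩
  | succ d ih =>
    obtain ⟨p, hp⟩ := exists_parent v (by rintro rfl; simp [Vert.depth] at hd)
    obtain ⟨w, hw⟩ := ih p (by have := hp.depth_eq; omega)
    have h2 := e.map_child (Child.inl (a := a) (r := r) hp)
    rw [hw, child_inl_iff] at h2
    exact ⟨_, h2.choose_spec.1⟩

theorem RootedIso.map_inr {e : RootedIso (node a l r) (node b l' r')}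
    (h : e.1 (.inr (.root r)) = .inr (.root r')) (v : Vert r) : ∃ w, e.1 (.inr v) = .inr w := by
  induction hd : v.depth generalizing v with
  | zero =>
    have : v = .root r := by
      by_contra hv
      obtain ⟨p, hp⟩ := exists_parent v hv
      have := hp.depth_eq
      omega
    exact ⟨_, this ▸ h⟩
  | succ d ih =>
    obtain ⟨p, hp⟩ := exists_parent v (by rintro rfl; simp [Vert.depth] at hd)
    obtain ⟨w, hw⟩ := ih p (by have := hp.depth_eq; omega)
    have h2 := e.map_child (Child.inr (a := a) (l := l) hp)
    rw [hw, child_inr_iff] at h2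
    exact ⟨_, h2.choose_spec.1⟩

theorem RootedIso.eq_keep {e : RootedIso (node a l r) (node b l' r')}
    (hl : e.1 (.inl (.root l)) = .inl (.root l')) (hr : e.1 (.inr (.root r)) = .inr (.root r')) :
    ∃ (f : RootedIso l l') (g : RootedIso r r'), e = f.keep g := by
  have hl' : e.symm.1 (.inl (.root l')) = .inl (.root l) := e.1.toEquiv.symm_apply_eq.2 hl.symm
  have hr' : e.symm.1 (.inr (.root r')) = .inr (.root r) := e.1.toEquiv.symm_apply_eq.2 hr.symm
  choose f hf using map_inl hl
  choose g hg using map_inr hr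
  choose f' hf' using map_inl hl'
  choose g' hg' using map_inr hr'
  have h1 : ∀ x, e.symm.1 (e.1 x) = x := fun x => e.1.symm_apply_apply x
  have h2 : ∀ x, e.1 (e.symm.1 x) = x := fun x => e.1.apply_symm_apply x
  refine ⟨.ofChild ⟨f, f', fun v => ?_, fun v => ?_⟩ (fun u v h => ?_) (fun u v h => ?_) ?_,
    .ofChild ⟨g, g', fun v => ?_, fun v => ?_⟩ (fun u v h => ?_) (fun u v h => ?_) ?_,
    RootedIso.ext fun v => ?_⟩
  · have := h1 (.inl v)
    rw [hf, hf'] at this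
    exact Vert.inl.inj this
  · have := h2 (.inl v)
    rw [hf', hf] at this
    exact Vert.inl.inj this
  · have := e.map_child (Child.inl (a := a) (r := r) h)
    rw [hf, hf] at this
    cases this
    assumption
  · have := e.symm.map_child (Child.inl (a := b) (r := r') h)
    rw [hf', hf'] at this
    cases this
    assumption
  · have := hf (.root l)
    rw [hl] at this
    exact (Vert.inl.inj this).symm
  · have := h1 (.inr v)
    rw [hg, hg'] at this
    exact Vert.inr.inj this
  · have := h2 (.inr v)
    rw [hg', hg] at this
    exact Vert.inr.inj this
  · have := e.map_child (Child.inr (a := a) (l := l) h)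
    rw [hg, hg] at this
    cases this
    assumption
  · have := e.symm.map_child (Child.inr (a := b) (l := l') h)
    rw [hg', hg'] at this
    cases this
    assumption
  · have := hg (.root r)
    rw [hr] at this
    exact (Vert.inr.inj this).symm
  · rcases v with _ | v | v
    · exact e.2
    · exact hf v
    · exact hg v

/-- The two children of the root go to the two children of the root. If they are crossed,
composition with a flip reduces to `eq_keep`, and flipping twice is the identity. -/
theorem RootedIso.keep_or_swap (e : RootedIso (node a l r) (node b l' r')) :
    (∃ (f : RootedIso l l') (g : RootedIso r r'), e = f.keep g) ∨
      ∃ (f : RootedIso l r') (g : RootedIso r l'),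
        e = RootedIso.trans (t := node b r' l') (f.keep g) (.flip _ _ _ _) := by
  have hl := e.map_child (Child.left a l r)
  have hr := e.map_child (Child.right a l r)
  have hne : e.1 (.inl (.root l)) ≠ e.1 (.inr (.root r)) := fun h => by
    have := e.1.injective h
    cases this
  rw [e.2, child_root_iff] at hl hr
  have key : ∀ v, ((e.trans (.flip b b l' r')).trans (.flip b b r' l')).1 v = e.1 v := fun v => by
    change Vert.flip (Vert.flip (e.1 v)) = e.1 v
    rcases e.1 v with _ | v | v <;> rfl
  have h2 := RootedIso.ext key
  rcases hl with hl | hl <;> rcases hr with hr | hr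
  · exact absurd (hl.trans hr.symm) hne
  · exact .inl (eq_keep hl hr)
  · refine .inr ?_
    obtain ⟨f, g, h⟩ := eq_keep (e := e.trans (.flip b b l' r'))
      (by change Vert.flip (e.1 _) = _; rw [hl]; rfl) (by change Vert.flip (e.1 _) = _; rw [hr]; rfl)
    exact ⟨f, g, by rw [← h, h2]⟩
  · exact absurd (hl.trans hr.symm) hne

end Join

instance leaf_nonempty (t : BinaryTree Unit) : Nonempty (Leaf t) := by
  rw [← Fintype.card_pos_iff, card_leaf]
  exact t.numLeaves_pos

section LeafAction

variable {a b : Unit} {l r l' r' : BinaryTree Unit}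

@[simp] theorem RootedIso.keep_leafEquiv_inl (e : RootedIso l l') (f : RootedIso r r')
    (x : Leaf l) : (e.keep f : RootedIso (node a l r) (node b l' r')).leafEquiv (Leaf.inl x) =
      Leaf.inl (e.leafEquiv x) := rfl

@[simp] theorem RootedIso.keep_leafEquiv_inr (e : RootedIso l l') (f : RootedIso r r')
    (x : Leaf r) : (e.keep f : RootedIso (node a l r) (node b l' r')).leafEquiv (Leaf.inr x) =
      Leaf.inr (f.leafEquiv x) := rfl

/-- Join isomorphisms of each branch with the opposite branch. -/
def RootedIso.swap (e : RootedIso l r') (f : RootedIso r l') :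
    RootedIso (node a l r) (node b l' r') :=
  RootedIso.trans (t := node b r' l') (e.keep f) (.flip _ _ _ _)

@[simp] theorem RootedIso.swap_leafEquiv_inl (e : RootedIso l r') (f : RootedIso r l')
    (x : Leaf l) : (e.swap f : RootedIso (node a l r) (node b l' r')).leafEquiv (Leaf.inl x) =
      Leaf.inr (e.leafEquiv x) := rfl

@[simp] theorem RootedIso.swap_leafEquiv_inr (e : RootedIso l r') (f : RootedIso r l')
    (x : Leaf r) : (e.swap f : RootedIso (node a l r) (node b l' r')).leafEquiv (Leaf.inr x) =
      Leaf.inl (f.leafEquiv x) := rfl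

end LeafAction

theorem not_rootedIso_nil_node {a : Unit} {l r : BinaryTree Unit} (e : RootedIso nil (node a l r)) :
    False := not_child_nil _ _ (e.symm.map_child (Child.left a l r))

theorem not_rootedIso_node_nil {a : Unit} {l r : BinaryTree Unit} (e : RootedIso (node a l r) nil) :
    False := not_child_nil _ _ (e.map_child (Child.left a l r))

/-- An isomorphism is determined by its action on the leaves. -/
theorem RootedIso.leafEquiv_injective (s t : BinaryTree Unit) :
    Function.Injective (RootedIso.leafEquiv : RootedIso s t → (Leaf s ≃ Leaf t)) := by
  intro e f h
  induction s generalizing t with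
  | nil =>
    cases t with
    | nil =>
      refine RootedIso.ext fun v => ?_
      generalize e.1 v = x
      generalize f.1 v = y
      cases x
      cases y
      rfl
    | node => exact (not_rootedIso_nil_node e).elim
  | node a l r ihl ihr =>
    cases t with
    | nil => exact (not_rootedIso_node_nil e).elim
    | node b l' r' =>
      have hL : ∀ x : Leaf l, _ := fun x => Equiv.congr_fun h (Leaf.inl x)
      have hR : ∀ x : Leaf r, _ := fun x => Equiv.congr_fun h (Leaf.inr x)
      obtain ⟨x⟩ := leaf_nonempty l
      have hx := hL x
      obtain ⟨e₁, e₂, rfl⟩ | ⟨e₁, e₂, rfl⟩ := e.keep_or_swap <;>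
      obtain ⟨f₁, f₂, rfl⟩ | ⟨f₁, f₂, rfl⟩ := f.keep_or_swap
      · rw [ihl _ (Equiv.ext fun x => Leaf.inl_inj.1 (hL x)),
          ihr _ (Equiv.ext fun x => Leaf.inr_inj.1 (hR x))]
      · exact (Leaf.inl_ne_inr (e₁.leafEquiv x) (f₁.leafEquiv x) hx).elim
      · exact (Leaf.inr_ne_inl (e₁.leafEquiv x) (f₁.leafEquiv x) hx).elim
      · rw [ihl _ (Equiv.ext fun x => Leaf.inr_inj.1 (hL x)),
          ihr _ (Equiv.ext fun x => Leaf.inl_inj.1 (hR x))]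

/-! ### Isomorphisms as recursive data, and their weighted enumeration -/

/-- Recursive description of the isomorphisms between plane binary trees. -/
inductive TreeIso : BinaryTree Unit → BinaryTree Unit → Type
  | nil : TreeIso nil nil
  | keep {a b : Unit} {l r l' r' : BinaryTree Unit} (f : TreeIso l l') (g : TreeIso r r') :
      TreeIso (node a l r) (node b l' r')
  | swap {a b : Unit} {l r l' r' : BinaryTree Unit} (f : TreeIso l r') (g : TreeIso r l') :
      TreeIso (node a l r) (node b l' r')

namespace TreeIso

/-- The isomorphism that is described. -/
def toRooted : {s t : BinaryTree Unit} → TreeIso s t → RootedIso s t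
  | _, _, nil => .refl _
  | _, _, keep f g => f.toRooted.keep g.toRooted
  | _, _, swap f g => f.toRooted.swap g.toRooted

/-- Injectivity is read off the leaves: `keep` and `swap` send a leaf of the left branch into
different branches, and no branch is without leaves. Surjectivity iterates `RootedIso.keep_or_swap`.
-/
theorem toRooted_bijective (s t : BinaryTree Unit) :
    Function.Bijective (toRooted : TreeIso s t → RootedIso s t) := by
  constructor
  · intro f g h
    induction f with
    | nil => cases g; rfl
    | @keep a b l r l' r' f₁ f₂ ih₁ ih₂ =>
      have h' : ∀ x, _ := fun x => Equiv.congr_fun (congrArg RootedIso.leafEquiv h) x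
      cases g with
      | keep g₁ g₂ =>
        rw [ih₁ (RootedIso.leafEquiv_injective _ _ (Equiv.ext fun x => Leaf.inl_inj.1 (h' (.inl x)))),
          ih₂ (RootedIso.leafEquiv_injective _ _ (Equiv.ext fun x => Leaf.inr_inj.1 (h' (.inr x))))]
      | swap g₁ g₂ =>
        obtain ⟨x⟩ := leaf_nonempty l
        exact (Leaf.inl_ne_inr (f₁.toRooted.leafEquiv x) (g₁.toRooted.leafEquiv x) (h' (.inl x))).elim
    | @swap a b l r l' r' f₁ f₂ ih₁ ih₂ =>
      have h' : ∀ x, _ := fun x => Equiv.congr_fun (congrArg RootedIso.leafEquiv h) x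
      cases g with
      | keep g₁ g₂ =>
        obtain ⟨x⟩ := leaf_nonempty l
        exact (Leaf.inr_ne_inl (f₁.toRooted.leafEquiv x) (g₁.toRooted.leafEquiv x) (h' (.inl x))).elim
      | swap g₁ g₂ =>
        rw [ih₁ (RootedIso.leafEquiv_injective _ _ (Equiv.ext fun x => Leaf.inr_inj.1 (h' (.inl x)))),
          ih₂ (RootedIso.leafEquiv_injective _ _ (Equiv.ext fun x => Leaf.inl_inj.1 (h' (.inr x))))]
  · intro e
    induction s generalizing t with
    | nil =>
      cases t with
      | nil => exact ⟨nil, RootedIso.leafEquiv_injective _ _ (Equiv.ext fun x => Subsingleton.elim _ _)⟩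
      | node => exact (not_rootedIso_nil_node e).elim
    | node a l r ihl ihr =>
      cases t with
      | nil => exact (not_rootedIso_node_nil e).elim
      | node b l' r' =>
        obtain ⟨f, g, rfl⟩ | ⟨f, g, rfl⟩ := e.keep_or_swap
        · obtain ⟨f, rfl⟩ := ihl _ f
          obtain ⟨g, rfl⟩ := ihr _ g
          exact ⟨keep f g, rfl⟩
        · obtain ⟨f, rfl⟩ := ihl _ f
          obtain ⟨g, rfl⟩ := ihr _ g
          exact ⟨swap f g, rfl⟩

/-- Isomorphisms and their recursive descriptions. -/
noncomputable def equivRooted (s t : BinaryTree Unit) : TreeIso s t ≃ RootedIso s t :=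
  Equiv.ofBijective _ (toRooted_bijective s t)

@[simp] theorem equivRooted_apply {s t : BinaryTree Unit} (f : TreeIso s t) :
    equivRooted s t f = f.toRooted := rfl

/-- Isomorphisms between trees that are not leaves are made of isomorphisms of the branches. -/
def nodeEquiv (a b : Unit) (l r l' r' : BinaryTree Unit) :
    (TreeIso l l' × TreeIso r r') ⊕ (TreeIso l r' × TreeIso r l') ≃
      TreeIso (node a l r) (node b l' r') where
  toFun
    | .inl (f, g) => keep f g
    | .inr (f, g) => swap f g
  invFun
    | keep f g => .inl (f, g)
    | swap f g => .inr (f, g)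
  left_inv := by rintro (⟨f, g⟩ | ⟨f, g⟩) <;> rfl
  right_inv := by rintro (⟨f, g⟩ | ⟨f, g⟩) <;> rfl

/-- The isomorphisms from a given tree are made of isomorphisms from its branches and
a choice whether to exchange the branches. -/
def sigmaNodeEquiv (a : Unit) (l r : BinaryTree Unit) :
    Bool × (Σ t, TreeIso l t) × (Σ t, TreeIso r t) ≃ Σ t, TreeIso (node a l r) t where
  toFun
    | (true, ⟨_, f⟩, ⟨_, g⟩) => ⟨node () _ _, keep f g⟩
    | (false, ⟨_, f⟩, ⟨_, g⟩) => ⟨node () _ _, swap f g⟩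
  invFun
    | ⟨_, keep f g⟩ => (true, ⟨_, f⟩, ⟨_, g⟩)
    | ⟨_, swap f g⟩ => (false, ⟨_, f⟩, ⟨_, g⟩)
  left_inv := by rintro ⟨_ | _, ⟨_, f⟩, ⟨_, g⟩⟩ <;> rfl
  right_inv := by rintro ⟨_, ⟨f, g⟩ | ⟨f, g⟩⟩ <;> rfl

/-- The only isomorphism from a single leaf. -/
def sigmaNilEquiv : Unit ≃ Σ t, TreeIso BinaryTree.nil t where
  toFun _ := ⟨_, nil⟩
  invFun _ := ()
  left_inv _ := rfl
  right_inv := by rintro ⟨_, ⟨⟩⟩; rfl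

/-- With the target left free, each of the `s.numLeaves - 1` internal vertices contributes an
independent binary choice. -/
theorem finite_and_card_sigma (s : BinaryTree Unit) :
    Finite (Σ t, TreeIso s t) ∧ Nat.card (Σ t, TreeIso s t) = 2 ^ (s.numLeaves - 1) := by
  induction s with
  | nil =>
    refine ⟨Finite.of_equiv _ sigmaNilEquiv, ?_⟩
    rw [← Nat.card_congr sigmaNilEquiv]
    simp
  | node a l r ihl ihr =>
    obtain ⟨_, hl⟩ := ihl
    obtain ⟨_, hr⟩ := ihr
    refine ⟨Finite.of_equiv _ (sigmaNodeEquiv a l r), ?_⟩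
    rw [← Nat.card_congr (sigmaNodeEquiv a l r), Nat.card_prod, Nat.card_prod, hl, hr]
    have h1 := l.numLeaves_pos
    have h2 := r.numLeaves_pos
    simp only [Nat.card_eq_fintype_card, Fintype.card_bool, BinaryTree.numLeaves]
    rw [← pow_add, ← pow_succ']
    congr 1
    omega

instance finite_sigma (s : BinaryTree Unit) : Finite (Σ t, TreeIso s t) :=
  (finite_and_card_sigma s).1

instance (s t : BinaryTree Unit) : Finite (TreeIso s t) :=
  Finite.of_injective (Sigma.mk t) sigma_mk_injective

noncomputable instance (s t : BinaryTree Unit) : Fintype (TreeIso s t) := Fintype.ofFinite _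

theorem card_le (s t : BinaryTree Unit) : Fintype.card (TreeIso s t) ≤ 2 ^ (s.numLeaves - 1) := by
  rw [← (finite_and_card_sigma s).2, ← Nat.card_eq_fintype_card]
  exact Nat.card_le_card_of_injective (Sigma.mk t) sigma_mk_injective

theorem numLeaves_eq {s t : BinaryTree Unit} (f : TreeIso s t) : s.numLeaves = t.numLeaves := by
  rw [← card_leaf, ← card_leaf]
  exact Fintype.card_congr f.toRooted.leafEquiv

/-- The number of vertices whose branches are exchanged while the branches at all vertices above
are kept. -/
def numSwaps : {s t : BinaryTree Unit} → TreeIso s t → ℕ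
  | _, _, nil => 0
  | _, _, keep f g => f.numSwaps + g.numSwaps
  | _, _, swap _ _ => 1

/-- The number of leaves below the vertices counted by `numSwaps`. -/
def numMoved : {s t : BinaryTree Unit} → TreeIso s t → ℕ
  | _, _, nil => 0
  | _, _, keep f g => f.numMoved + g.numMoved
  | node _ l r, _, swap _ _ => l.numLeaves + r.numLeaves

/-- The branches exchanged at a vertex are isomorphic, hence have equally many leaves. -/
theorem even_numMoved {t : BinaryTree Unit} (f : TreeIso t t) : Even f.numMoved := by
  induction t with
  | nil => cases f; exact Even.zero
  | node a l r ihl ihr =>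
    cases f with
    | keep f g => exact (ihl f).add (ihr g)
    | swap f g => exact ⟨l.numLeaves, by simp [numMoved, f.numLeaves_eq]⟩

theorem two_mul_numSwaps_le {t : BinaryTree Unit} (f : TreeIso t t) :
    2 * f.numSwaps ≤ f.numMoved := by
  induction t with
  | nil => cases f; exact le_rfl
  | node a l r ihl ihr =>
    cases f with
    | keep f g =>
      have := ihl f
      have := ihr g
      simp only [numSwaps, numMoved]
      omega
    | swap f g =>
      have := l.numLeaves_pos
      have := r.numLeaves_pos
      simp only [numSwaps, numMoved]
      omega

open Classical in
-- Every leaf below an exchanged vertex changes branch and so is moved; whatever happens further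
-- down does not matter. This is why only topmost exchanges are recorded.
theorem card_support {t : BinaryTree Unit} (f : TreeIso t t) :
    Finset.card (Equiv.Perm.support (f.toRooted.leafEquiv : Equiv.Perm (Leaf t))) = f.numMoved := by
  have key : ∀ (t : BinaryTree Unit) (f : TreeIso t t),
      (∑ x : Leaf t, if f.toRooted.leafEquiv x ≠ x then 1 else 0) = f.numMoved := by
    intro t f
    induction t with
    | nil =>
      cases f
      exact Finset.sum_eq_zero fun x _ => if_neg (not_not.2 (Subsingleton.elim _ _))
    | node a l r ihl ihr =>
      rw [← (leafNodeEquiv a l r).sum_comp, Fintype.sum_sum_type]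
      cases f with
      | keep f g => simp [toRooted, numMoved, ← ihl, ← ihr]
      | swap f g => simp [toRooted, numMoved, card_leaf]
  rw [← key, Finset.sum_boole]
  rfl

/-- The weighted count of the automorphisms of a tree. -/
theorem sum_weight_le (t : BinaryTree Unit) {x : ℝ} (hx : 0 ≤ x) :
    ∑ f : TreeIso t t, x ^ f.numSwaps * (1 / 2) ^ f.numMoved ≤ (1 + x) ^ (t.numLeaves - 1) := by
  induction t with
  | nil =>
    have : ∀ f : TreeIso .nil .nil, f = nil := by rintro ⟨⟩; rfl
    rw [Fintype.sum_eq_single nil fun f hf => absurd (this f) hf]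
    simp [numSwaps, numMoved]
  | node a l r ihl ihr =>
    rw [← (nodeEquiv a a l r l r).sum_comp, Fintype.sum_sum_type, Fintype.sum_prod_type,
      Fintype.sum_prod_type]
    simp only [nodeEquiv, Equiv.coe_fn_mk, numSwaps, numMoved, BinaryTree.numLeaves, pow_add]
    obtain ⟨m, hm⟩ := Nat.exists_eq_add_one.2 l.numLeaves_pos
    obtain ⟨n, hn⟩ := Nat.exists_eq_add_one.2 r.numLeaves_pos
    have hl : (Fintype.card (TreeIso l r) : ℝ) ≤ 2 ^ m := by
      exact_mod_cast (card_le l r).trans (by simp [hm])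
    have hr : (Fintype.card (TreeIso r l) : ℝ) ≤ 2 ^ n := by
      exact_mod_cast (card_le r l).trans (by simp [hn])
    rw [hm] at ihl ⊢
    rw [hn] at ihr ⊢
    rw [Nat.add_sub_cancel] at ihl ihr
    rw [show m + 1 + (n + 1) - 1 = m + n + 1 by omega]
    -- If the root is kept, the weight is multiplicative over the branches.
    have h1 : ∑ f : TreeIso l l, ∑ g : TreeIso r r, x ^ f.numSwaps * x ^ g.numSwaps *
        ((1 / 2) ^ f.numMoved * (1 / 2) ^ g.numMoved) ≤ (1 + x) ^ (m + n) := by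
      rw [pow_add]
      refine le_trans (le_of_eq ?_) (mul_le_mul ihl ihr (by positivity) (by positivity))
      rw [Finset.sum_mul_sum]
      refine Finset.sum_congr rfl fun f _ => Finset.sum_congr rfl fun g _ => ?_
      -- Both exponents are additive under `keep`, so the product of the two sums has these terms.
      ring
    -- If the root is swapped, there are at most `2 ^ m * 2 ^ n` pairs, each of weight `x * 2 ^ (-(m
    -- + n + 2))`. The total `x / 4` is well below the missing part `x * (1 + x) ^ (m + n)` of the
    -- bound.
    have h2 : ∑ f : TreeIso l r, ∑ g : TreeIso r l,
        x ^ 1 * ((1 / 2) ^ (m + 1) * (1 / 2) ^ (n + 1)) ≤ x * (1 + x) ^ (m + n) := by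
      simp only [Finset.sum_const, Finset.card_univ, nsmul_eq_mul]
      calc _ = x * ((Fintype.card (TreeIso l r) * Fintype.card (TreeIso r l)) *
            ((1 / 2) ^ (m + 1) * (1 / 2) ^ (n + 1))) := by ring
        _ ≤ x * ((2 ^ m * 2 ^ n) * ((1 / 2) ^ (m + 1) * (1 / 2) ^ (n + 1))) := by gcongr
        _ = x * (1 / 4) := by
          rw [pow_succ, pow_succ]
          have h3 : (2 : ℝ) ^ m * (1 / 2) ^ m = 1 := by rw [← mul_pow]; norm_num
          have h4 : (2 : ℝ) ^ n * (1 / 2) ^ n = 1 := by rw [← mul_pow]; norm_num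
          linear_combination x * (1 / 4) * ((2 : ℝ) ^ n * (1 / 2) ^ n) * h3 + x * (1 / 4) * h4
        _ ≤ x * (1 + x) ^ (m + n) := by
          gcongr
          exact le_trans (by norm_num) (one_le_pow₀ (by linarith))
    calc _ ≤ (1 + x) ^ (m + n) + x * (1 + x) ^ (m + n) := add_le_add h1 h2
      _ = _ := by ring

end TreeIso

/-! ### Cherries and the automorphisms that interchange them -/

section Cherries

theorem mk_mem_cherries_iff {t : BinaryTree Unit} {x y : Leaf t} :
    s(x, y) ∈ cherries t ↔ x ≠ y ∧ ∃ p, Child p x.1 ∧ Child p y.1 := by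
  constructor
  · rintro ⟨x', y', hne, ⟨p, hx, hy⟩, h⟩
    rcases Sym2.eq_iff.1 h with ⟨rfl, rfl⟩ | ⟨rfl, rfl⟩
    · exact ⟨hne, p, hx, hy⟩
    · exact ⟨hne.symm, p, hy, hx⟩
  · rintro ⟨hne, hp⟩
    exact ⟨x, y, hne, hp, rfl⟩

variable {a : Unit} {l r : BinaryTree Unit}

theorem inl_inl_mem_cherries_iff {x y : Leaf l} :
    s((Leaf.inl x : Leaf (node a l r)), Leaf.inl y) ∈ cherries (node a l r) ↔
      s(x, y) ∈ cherries l := by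
  rw [mk_mem_cherries_iff, mk_mem_cherries_iff, Ne, Leaf.inl_inj]
  refine and_congr_right fun hne => ⟨?_, ?_⟩
  · rintro ⟨p, hx, hy⟩
    rcases p with _ | p | p
    · rw [child_root_iff] at hx hy
      rcases hx with hx | hx
      · rcases hy with hy | hy
        · exact absurd (Subtype.ext (Vert.inl.inj (hx.trans hy.symm))) hne
        · cases hy
      · cases hx
    · obtain ⟨_, hx', hx⟩ := child_inl_iff.1 hx
      obtain ⟨_, hy', hy⟩ := child_inl_iff.1 hy
      exact ⟨p, Vert.inl.inj hx' ▸ hx, Vert.inl.inj hy' ▸ hy⟩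
    · obtain ⟨_, hx', -⟩ := child_inr_iff.1 hx
      cases hx'
  · rintro ⟨p, hx, hy⟩
    exact ⟨_, .inl hx, .inl hy⟩

theorem inr_inr_mem_cherries_iff {x y : Leaf r} :
    s((Leaf.inr x : Leaf (node a l r)), Leaf.inr y) ∈ cherries (node a l r) ↔
      s(x, y) ∈ cherries r := by
  rw [mk_mem_cherries_iff, mk_mem_cherries_iff, Ne, Leaf.inr_inj]
  refine and_congr_right fun hne => ⟨?_, ?_⟩
  · rintro ⟨p, hx, hy⟩
    rcases p with _ | p | p
    · rw [child_root_iff] at hx hy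
      rcases hx with hx | hx
      · cases hx
      · rcases hy with hy | hy
        · cases hy
        · exact absurd (Subtype.ext (Vert.inr.inj (hx.trans hy.symm))) hne
    · obtain ⟨_, hx', -⟩ := child_inl_iff.1 hx
      cases hx'
    · obtain ⟨_, hx', hx⟩ := child_inr_iff.1 hx
      obtain ⟨_, hy', hy⟩ := child_inr_iff.1 hy
      exact ⟨p, Vert.inr.inj hx' ▸ hx, Vert.inr.inj hy' ▸ hy⟩
  · rintro ⟨p, hx, hy⟩
    exact ⟨_, .inr hx, .inr hy⟩

theorem eq_nil_of_root_leaf {t : BinaryTree Unit} (h : ∀ w, ¬ Child (Vert.root t) w) : t = nil := by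
  cases t with
  | nil => rfl
  | node a l r => exact absurd (Child.left a l r) (h _)

theorem inl_inr_mem_cherries_iff {x : Leaf l} {y : Leaf r} :
    s((Leaf.inl x : Leaf (node a l r)), Leaf.inr y) ∈ cherries (node a l r) ↔
      l = nil ∧ r = nil := by
  rw [mk_mem_cherries_iff]
  constructor
  · rintro ⟨-, p, hx, hy⟩
    rcases p with _ | p | p
    · rw [child_root_iff] at hx hy
      rcases hx with hx | hx
      · rcases hy with hy | hy
        · cases hy
        · exact ⟨eq_nil_of_root_leaf (Vert.inl.inj hx ▸ x.2),
            eq_nil_of_root_leaf (Vert.inr.inj hy ▸ y.2)⟩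
      · cases hx
    · obtain ⟨_, hy', -⟩ := child_inl_iff.1 hy
      cases hy'
    · obtain ⟨_, hx', -⟩ := child_inr_iff.1 hx
      cases hx'
  · rintro ⟨rfl, rfl⟩
    rw [x.eq_single, y.eq_single]
    exact ⟨Leaf.inl_ne_inr _ _, .root _, .left _ _ _, .right _ _ _⟩

theorem inr_inl_mem_cherries_iff {x : Leaf l} {y : Leaf r} :
    s((Leaf.inr y : Leaf (node a l r)), Leaf.inl x) ∈ cherries (node a l r) ↔
      l = nil ∧ r = nil := by
  rw [Sym2.eq_swap, inl_inr_mem_cherries_iff]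

theorem not_mem_cherries_nil (c : Sym2 (Leaf nil)) : c ∉ cherries nil := by
  rintro ⟨x, y, hne, -⟩
  exact hne (Subsingleton.elim _ _)

/-- A leaf belongs to at most one cherry. -/
theorem cherry_unique {t : BinaryTree Unit} {x y z : Leaf t} (hy : s(x, y) ∈ cherries t)
    (hz : s(x, z) ∈ cherries t) : y = z := by
  induction t with
  | nil => exact Subsingleton.elim _ _
  | node a l r ihl ihr =>
    obtain ⟨x, rfl⟩ | ⟨x, rfl⟩ := x.inl_or_inr <;> obtain ⟨y, rfl⟩ | ⟨y, rfl⟩ := y.inl_or_inr <;>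
    obtain ⟨z, rfl⟩ | ⟨z, rfl⟩ := z.inl_or_inr <;>
    simp only [inl_inl_mem_cherries_iff, inr_inr_mem_cherries_iff, inl_inr_mem_cherries_iff,
      inr_inl_mem_cherries_iff] at hy hz
    · rw [ihl hy hz]
    · obtain ⟨rfl, rfl⟩ := hz
      exact absurd hy (not_mem_cherries_nil _)
    · obtain ⟨rfl, rfl⟩ := hy
      exact absurd hz (not_mem_cherries_nil _)
    · obtain ⟨rfl, rfl⟩ := hy
      rw [y.eq_single, z.eq_single]
    · obtain ⟨rfl, rfl⟩ := hy
      rw [y.eq_single, z.eq_single]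
    · obtain ⟨rfl, rfl⟩ := hy
      exact absurd hz (not_mem_cherries_nil _)
    · obtain ⟨rfl, rfl⟩ := hz
      exact absurd hy (not_mem_cherries_nil _)
    · rw [ihr hy hz]

end Cherries

/-- An automorphism of a tree that does nothing but interchange the leaves of some cherries. -/
def RootedIso.IsCherryAut {t : BinaryTree Unit} (e : RootedIso t t) : Prop :=
  ∀ x, e.leafEquiv x = x ∨ s(x, e.leafEquiv x) ∈ cherries t

namespace RootedIso

variable {t : BinaryTree Unit}

theorem IsCherryAut.apply_apply {e : RootedIso t t} (he : e.IsCherryAut) (x : Leaf t) :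
    e.leafEquiv (e.leafEquiv x) = x := by
  rcases he x with h | h
  · rw [h, h]
  · rcases he (e.leafEquiv x) with h' | h'
    · rw [h', e.leafEquiv.injective h']
    · rw [Sym2.eq_swap] at h
      exact (cherry_unique h h').symm

/-- Each leaf lies in at most one cherry, so `e` and `e.trans f` act within the same pairs, and so
does `f`. This is the coset property behind `Rep.card_induced_le_of_not_allAutInduced`. -/
theorem IsCherryAut.of_trans {e f : RootedIso t t} (he : e.IsCherryAut)
    (hf : (e.trans f).IsCherryAut) : f.IsCherryAut := by
  intro x
  have h1 := hf (e.leafEquiv x)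
  have h2 : (e.trans f).leafEquiv (e.leafEquiv x) = f.leafEquiv x :=
    congrArg f.leafEquiv (he.apply_apply x)
  rw [h2] at h1
  rcases h1 with h1 | h1
  · rw [h1]
    exact he x
  · rcases he x with h3 | h3
    · rw [h3] at h1
      exact .inr h1
    · rw [Sym2.eq_swap] at h3
      exact .inl (cherry_unique h1 h3)

/-- Any set of cherries is interchanged by some automorphism that fixes all other leaves. -/
theorem exists_interchange (t : BinaryTree Unit) (C : Set (Sym2 (Leaf t))) (hC : C ⊆ cherries t) :
    ∃ e : RootedIso t t, ∀ x, (∀ y, s(x, y) ∈ C → e.leafEquiv x = y) ∧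
      ((∀ c ∈ C, x ∉ c) → e.leafEquiv x = x) := by
  induction t with
  | nil => exact ⟨.refl _, fun x => ⟨fun y _ => Subsingleton.elim _ _, fun _ => rfl⟩⟩
  | node a l r ihl ihr =>
    by_cases hs : ∃ x y, s((Leaf.inl x : Leaf (node a l r)), Leaf.inr y) ∈ C
    · obtain ⟨x, y, hxy⟩ := hs
      obtain ⟨rfl, rfl⟩ := inl_inr_mem_cherries_iff.1 (hC hxy)
      rw [x.eq_single, y.eq_single] at hxy
      refine ⟨RootedIso.swap (.refl _) (.refl _), fun z => ?_⟩
      obtain ⟨z, rfl⟩ | ⟨z, rfl⟩ := z.inl_or_inr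
      · rw [z.eq_single]
        refine ⟨fun w hw => ?_, fun h => absurd (Sym2.mem_mk_left _ _) (h _ hxy)⟩
        exact cherry_unique (hC hxy) (hC hw)
      · rw [z.eq_single]
        refine ⟨fun w hw => ?_, fun h => absurd (Sym2.mem_mk_right _ _) (h _ hxy)⟩
        rw [Sym2.eq_swap] at hxy
        exact cherry_unique (hC hxy) (hC hw)
    · push Not at hs
      obtain ⟨e, he⟩ := ihl {c | c.map Leaf.inl ∈ C} (by
        intro c
        induction c using Sym2.ind with
        | _ x y => exact fun h => inl_inl_mem_cherries_iff.1 (hC h))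
      obtain ⟨f, hf⟩ := ihr {c | c.map Leaf.inr ∈ C} (by
        intro c
        induction c using Sym2.ind with
        | _ x y => exact fun h => inr_inr_mem_cherries_iff.1 (hC h))
      refine ⟨e.keep f, fun x => ?_⟩
      obtain ⟨x, rfl⟩ | ⟨x, rfl⟩ := x.inl_or_inr
      · refine ⟨fun y hy => ?_, fun h => ?_⟩
        · obtain ⟨y, rfl⟩ | ⟨y, rfl⟩ := y.inl_or_inr
          · exact congrArg Leaf.inl ((he x).1 y hy)
          · exact absurd hy (hs _ _)
        · exact congrArg Leaf.inl
            ((he x).2 fun c hc hx => h _ hc (Sym2.mem_map.2 ⟨x, hx, rfl⟩))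
      · refine ⟨fun y hy => ?_, fun h => ?_⟩
        · obtain ⟨y, rfl⟩ | ⟨y, rfl⟩ := y.inl_or_inr
          · exact absurd (Sym2.eq_swap ▸ hy) (hs _ _)
          · exact congrArg Leaf.inr ((hf x).1 y hy)
        · exact congrArg Leaf.inr
            ((hf x).2 fun c hc hx => h _ hc (Sym2.mem_map.2 ⟨x, hx, rfl⟩))

end RootedIso

/-- Every topmost exchange moves at least two leaves, and exactly two only at a cherry. Since
`two_mul_numSwaps_le` holds in each branch, equality for the whole tree forces it in both. -/
theorem TreeIso.isCherryAut_iff {t : BinaryTree Unit} (f : TreeIso t t) :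
    f.toRooted.IsCherryAut ↔ f.numMoved = 2 * f.numSwaps := by
  induction t with
  | nil =>
    cases f
    exact iff_of_true (fun x => .inl (Subsingleton.elim _ _)) rfl
  | node a l r ihl ihr =>
    cases f with
    | keep f g =>
      have h1 := f.two_mul_numSwaps_le
      have h2 := g.two_mul_numSwaps_le
      have h3 : (keep f g : TreeIso (node a l r) (node a l r)).toRooted.IsCherryAut ↔
          f.toRooted.IsCherryAut ∧ g.toRooted.IsCherryAut := by
        constructor
        · refine fun h => ⟨fun x => ?_, fun x => ?_⟩
          · have := h (Leaf.inl x)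
            simp only [toRooted, RootedIso.keep_leafEquiv_inl, inl_inl_mem_cherries_iff,
              Leaf.inl_inj] at this
            exact this
          · have := h (Leaf.inr x)
            simp only [toRooted, RootedIso.keep_leafEquiv_inr, inr_inr_mem_cherries_iff,
              Leaf.inr_inj] at this
            exact this
        · rintro ⟨hf, hg⟩ x
          obtain ⟨x, rfl⟩ | ⟨x, rfl⟩ := x.inl_or_inr
          · simp only [toRooted, RootedIso.keep_leafEquiv_inl, inl_inl_mem_cherries_iff,
              Leaf.inl_inj]
            exact hf x
          · simp only [toRooted, RootedIso.keep_leafEquiv_inr, inr_inr_mem_cherries_iff,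
              Leaf.inr_inj]
            exact hg x
      rw [h3, ihl, ihr]
      simp only [numMoved, numSwaps]
      omega
    | swap f g =>
      have h3 : (swap f g : TreeIso (node a l r) (node a l r)).toRooted.IsCherryAut ↔
          l = .nil ∧ r = .nil := by
        constructor
        · intro h
          obtain ⟨x⟩ := leaf_nonempty l
          have := h (Leaf.inl x)
          simpa only [toRooted, RootedIso.swap_leafEquiv_inl, inl_inr_mem_cherries_iff,
            Leaf.inr_ne_inl, false_or] using this
        · rintro h x
          obtain ⟨x, rfl⟩ | ⟨x, rfl⟩ := x.inl_or_inr
          · simp only [toRooted, RootedIso.swap_leafEquiv_inl, inl_inr_mem_cherries_iff]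
            exact .inr h
          · simp only [toRooted, RootedIso.swap_leafEquiv_inr, inr_inl_mem_cherries_iff]
            exact .inr h
      have h4 : ∀ t : BinaryTree Unit, t.numLeaves = 1 ↔ t = .nil := by
        rintro (_ | ⟨b, l, r⟩)
        · simp
        · have := l.numLeaves_pos
          have := r.numLeaves_pos
          simp only [BinaryTree.numLeaves, reduceCtorEq, iff_false]
          omega
      rw [h3, ← h4, ← h4]
      have := l.numLeaves_pos
      have := r.numLeaves_pos
      simp only [numMoved, numSwaps]
      omega

/-! ### Induced automorphisms and sets of matched cherries -/

namespace Rep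

variable {n : ℕ} {X : Rep n}

/-- The set of interchanged pairs serves as `C`. The right-hand action is the left-hand one carried
over by the matching, so if both sides only interchange cherries, the interchanged pairs are matched
cherries. -/
theorem isInduced_iff {f : Iso X X} :
    X.IsInduced f ↔ f.left.IsCherryAut ∧ f.right.IsCherryAut := by
  constructor
  · rintro ⟨C, hC, h⟩
    have key : ∀ x, f.left.leafEquiv x = x ∨ s(x, f.left.leafEquiv x) ∈ X.matchedCherries := by
      intro x
      by_cases hx : ∀ c ∈ C, x ∉ c
      · exact .inl ((h x).2 hx)
      · push Not at hx
        obtain ⟨c, hc, y, rfl⟩ := hx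
        rw [(h x).1 y hc]
        exact .inr (hC hc)
    refine ⟨fun x => (key x).imp_right fun h => h.1, fun y => ?_⟩
    obtain ⟨x, rfl⟩ := X.matching.surjective y
    rw [f.matching]
    exact (key x).imp (congrArg _) fun h => h.2
  · rintro ⟨hl, hr⟩
    refine ⟨{c | ∃ x, f.left.leafEquiv x ≠ x ∧ c = s(x, f.left.leafEquiv x)}, ?_, fun x => ⟨?_, ?_⟩⟩
    · rintro _ ⟨x, hx, rfl⟩
      refine ⟨(hl x).resolve_left hx, ?_⟩
      have := hr (X.matching x)
      rw [f.matching] at this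
      exact this.resolve_left fun h => hx (X.matching.injective h)
    · rintro y ⟨z, hz, h⟩
      rcases Sym2.eq_iff.1 h with ⟨rfl, rfl⟩ | ⟨rfl, rfl⟩
      · rfl
      · exact hl.apply_apply _
    · intro h
      by_contra hx
      exact h _ ⟨x, hx, rfl⟩ (Sym2.mem_mk_left _ _)

theorem _root_.RandomTanglegram.Iso.ext_left {Y : Rep n} {f g : Iso X Y}
    (h : f.left.leafEquiv = g.left.leafEquiv) : f = g := by
  have h1 : f.left = g.left := RootedIso.leafEquiv_injective _ _ h
  have h2 : f.right = g.right := RootedIso.leafEquiv_injective _ _ <| Equiv.ext fun y => by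
    obtain ⟨x, rfl⟩ := X.matching.surjective y
    rw [f.matching, g.matching, h]
  obtain ⟨fl, fr, _⟩ := f
  obtain ⟨gl, gr, _⟩ := g
  subst h1 h2
  rfl

/-- The cherries that are interchanged by an automorphism. -/
def interchanged (f : Iso X X) : Set (Sym2 (Leaf X.left)) :=
  {c | ∃ x, f.left.leafEquiv x ≠ x ∧ c = s(x, f.left.leafEquiv x)}

theorem mk_mem_interchanged {f : Iso X X} (hf : X.IsInduced f) {x y : Leaf X.left} :
    s(x, y) ∈ interchanged f ↔ x ≠ y ∧ f.left.leafEquiv x = y := by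
  constructor
  · rintro ⟨z, hz, h⟩
    rcases Sym2.eq_iff.1 h with ⟨rfl, rfl⟩ | ⟨rfl, rfl⟩
    · exact ⟨hz.symm, rfl⟩
    · exact ⟨hz, (isInduced_iff.1 hf).1.apply_apply _⟩
  · rintro ⟨hne, rfl⟩
    exact ⟨x, hne.symm, rfl⟩

theorem interchanged_subset {f : Iso X X} (hf : X.IsInduced f) :
    interchanged f ⊆ X.matchedCherries := by
  obtain ⟨hl, hr⟩ := isInduced_iff.1 hf
  rintro _ ⟨x, hx, rfl⟩
  refine ⟨(hl x).resolve_left hx, ?_⟩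
  have := hr (X.matching x)
  rw [f.matching] at this
  exact this.resolve_left fun h => hx (X.matching.injective h)

theorem interchanged_injOn : Set.InjOn interchanged {f : Iso X X | X.IsInduced f} := by
  intro f hf g hg h
  refine Iso.ext_left (Equiv.ext fun x => ?_)
  by_cases hx : f.left.leafEquiv x = x
  · by_cases hx' : g.left.leafEquiv x = x
    · rw [hx, hx']
    · have := (mk_mem_interchanged hg).2 ⟨Ne.symm hx', rfl⟩
      rw [← h, mk_mem_interchanged hf] at this
      exact this.2
  · have := (mk_mem_interchanged hf).2 ⟨Ne.symm hx, rfl⟩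
    rw [h, mk_mem_interchanged hg] at this
    exact this.2.symm

theorem exists_interchanged_eq {C : Set (Sym2 (Leaf X.left))} (hC : C ⊆ X.matchedCherries) :
    ∃ f : Iso X X, X.IsInduced f ∧ interchanged f = C := by
  obtain ⟨e, he⟩ := RootedIso.exists_interchange X.left C fun c hc => (hC hc).1
  obtain ⟨e', he'⟩ := RootedIso.exists_interchange X.right (Sym2.map X.matching '' C) <| by
    rintro _ ⟨c, hc, rfl⟩
    exact (hC hc).2
  -- Both sides are determined by whether `x` lies in a pair of `C`, because the right-hand set is
  -- the image of `C` under the matching.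
  have hm : ∀ x, e'.leafEquiv (X.matching x) = X.matching (e.leafEquiv x) := by
    intro x
    by_cases hx : ∀ c ∈ C, x ∉ c
    · rw [(he x).2 hx, (he' _).2]
      rintro _ ⟨c, hc, rfl⟩ hxc
      obtain ⟨y, hy, h⟩ := Sym2.mem_map.1 hxc
      exact hx c hc (X.matching.injective h ▸ hy)
    · push Not at hx
      obtain ⟨c, hc, y, rfl⟩ := hx
      rw [(he x).1 y hc]
      exact (he' _).1 _ ⟨_, hc, rfl⟩
  have hi : X.IsInduced ⟨e, e', hm⟩ := ⟨C, hC, he⟩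
  refine ⟨⟨e, e', hm⟩, hi, Set.ext fun c => ?_⟩
  induction c using Sym2.ind with
  | _ x y =>
    rw [mk_mem_interchanged hi]
    constructor
    · rintro ⟨hne, h⟩
      by_contra hxy
      by_cases hx : ∀ c ∈ C, x ∉ c
      · exact hne (((he x).2 hx).symm.trans h)
      · push Not at hx
        obtain ⟨c, hc, z, rfl⟩ := hx
        have : z = y := ((he x).1 z hc).symm.trans h
        exact hxy (this ▸ hc)
    · intro h
      refine ⟨?_, (he x).1 y h⟩
      exact (mk_mem_cherries_iff.1 (hC h).1).1

/-- Automorphisms induced by matched cherries correspond to sets of matched cherries. -/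
noncomputable def inducedEquiv (X : Rep n) :
    {f : Iso X X // X.IsInduced f} ≃ {C // C ⊆ X.matchedCherries} :=
  Equiv.ofBijective (fun f => ⟨interchanged f.1, interchanged_subset f.2⟩) <| by
    constructor
    · intro f g h
      exact Subtype.ext (interchanged_injOn f.2 g.2 (congrArg Subtype.val h))
    · rintro ⟨C, hC⟩
      obtain ⟨f, hf, rfl⟩ := exists_interchanged_eq hC
      exact ⟨⟨f, hf⟩, rfl⟩

open Classical in
theorem card_support_eq {f : Iso X X} (hf : X.IsInduced f) :
    Finset.card (Equiv.Perm.support (f.left.leafEquiv : Equiv.Perm (Leaf X.left))) =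
      2 * (interchanged f).ncard := by
  have hfin : (interchanged f).Finite := Set.toFinite _
  rw [Set.ncard_eq_toFinset_card _ hfin]
  have h1 : Equiv.Perm.support (f.left.leafEquiv : Equiv.Perm (Leaf X.left)) =
      hfin.toFinset.biUnion Sym2.toFinset := by
    ext x
    rw [Equiv.Perm.mem_support, Finset.mem_biUnion]
    constructor
    · intro hx
      exact ⟨s(x, f.left.leafEquiv x), by simpa using (mk_mem_interchanged hf).2 ⟨Ne.symm hx, rfl⟩,
        by simp⟩
    · rintro ⟨c, hc, hx⟩
      rw [Sym2.mem_toFinset] at hx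
      obtain ⟨y, rfl⟩ := hx
      rw [Set.Finite.mem_toFinset, mk_mem_interchanged hf] at hc
      intro h
      exact hc.1 (h.symm.trans hc.2)
  rw [h1, Finset.card_biUnion, Finset.sum_const_nat (m := 2), mul_comm]
  · intro c hc
    rw [Set.Finite.mem_toFinset] at hc
    obtain ⟨x, hx, rfl⟩ := hc
    exact Sym2.card_toFinset_of_not_isDiag _ (by simpa using Ne.symm hx)
  · intro c hc d hd hne
    refine Finset.disjoint_left.2 fun x hxc hxd => ?_
    rw [Finset.mem_coe] at hc hd
    rw [Sym2.mem_toFinset] at hxc hxd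
    obtain ⟨y, rfl⟩ := hxc
    obtain ⟨z, rfl⟩ := hxd
    rw [Set.Finite.mem_toFinset, mk_mem_interchanged hf] at hc hd
    rw [← hc.2, ← hd.2] at hne
    exact hne rfl

instance (X Y : Rep n) : Finite (Iso X Y) :=
  Finite.of_injective (fun f : Iso X Y => f.left.leafEquiv) fun _ _ h => Iso.ext_left h

theorem card_induced (X : Rep n) :
    Nat.card {f : Iso X X // X.IsInduced f} = 2 ^ X.numMatchedCherries := by
  rw [Nat.card_congr X.inducedEquiv, numMatchedCherries, ← Set.ncard_powerset _ (Set.toFinite _)]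
  rfl

open Classical in
-- Expresses the binomial moment through automorphisms of a prescribed support size, a form in which
-- the sum over representatives can be reordered.
theorem card_induced_support (X : Rep n) (j : ℕ) :
    Nat.card {f : Iso X X // X.IsInduced f ∧
      Finset.card (Equiv.Perm.support (f.left.leafEquiv : Equiv.Perm (Leaf X.left))) = 2 * j} =
      X.numMatchedCherries.choose j := by
  have e : {f : Iso X X // X.IsInduced f ∧
      Finset.card (Equiv.Perm.support (f.left.leafEquiv : Equiv.Perm (Leaf X.left))) = 2 * j} ≃
      {C : {C // C ⊆ X.matchedCherries} // C.1.ncard = j} :=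
    (Equiv.subtypeSubtypeEquivSubtypeInter _ _).symm.trans <|
      X.inducedEquiv.subtypeEquiv fun f => by
        rw [card_support_eq f.2]
        change 2 * _ = 2 * j ↔ (interchanged f.1).ncard = j
        omega
  have hfin : X.matchedCherries.Finite := Set.toFinite _
  rw [Nat.card_congr e, numMatchedCherries, Set.ncard_eq_toFinset_card _ hfin,
    ← Finset.card_powersetCard, ← Fintype.card_coe, ← Nat.card_eq_fintype_card]
  symm
  refine Nat.card_eq_of_bijective (fun s => ⟨⟨(s.1 : Set _), ?_⟩, ?_⟩) ⟨?_, ?_⟩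
  · exact fun c hc => hfin.mem_toFinset.1 ((Finset.mem_powersetCard.1 s.2).1 hc)
  · exact (Set.ncard_coe_finset _).trans (Finset.mem_powersetCard.1 s.2).2
  · intro s s' h
    exact Subtype.ext (Finset.coe_injective (congrArg (fun C => C.1.1) h))
  · rintro ⟨⟨C, hC⟩, hj⟩
    have hC' : C.Finite := hfin.subset hC
    refine ⟨⟨hC'.toFinset, Finset.mem_powersetCard.2 ⟨fun c hc => ?_, ?_⟩⟩, ?_⟩
    · simpa using hC (by simpa using hc)
    · rw [← hj, Set.ncard_eq_toFinset_card _ hC']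
    · simp

theorem allAutInduced_iff (X : Rep n) :
    X.AllAutInduced ↔ Nat.card {f : Iso X X // ¬ X.IsInduced f} = 0 := by
  rw [Finite.card_eq_zero_iff, isEmpty_subtype]
  simp [AllAutInduced]

theorem numAut_eq_add (X : Rep n) : X.numAut =
    2 ^ X.numMatchedCherries + Nat.card {f : Iso X X // ¬ X.IsInduced f} := by
  classical
  rw [← card_induced, ← Nat.card_sum, numAut]
  exact Nat.card_congr (Equiv.sumCompl _).symm

/-- Composing the induced automorphisms with one that is not induced gives as many distinct
automorphisms that are not induced. -/
theorem card_induced_le_of_not_allAutInduced (h : ¬ X.AllAutInduced) :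
    2 ^ X.numMatchedCherries ≤ Nat.card {f : Iso X X // ¬ X.IsInduced f} := by
  obtain ⟨g, hg⟩ := not_forall.1 h
  rw [← card_induced]
  refine Nat.card_le_card_of_injective (fun f => ⟨f.1.trans g, fun hfg => hg ?_⟩) ?_
  · rw [isInduced_iff] at hfg ⊢
    have := isInduced_iff.1 f.2
    exact ⟨this.1.of_trans hfg.1, this.2.of_trans hfg.2⟩
  · intro f f' hff
    refine Subtype.ext (Iso.ext_left (Equiv.ext fun x => g.left.leafEquiv.injective ?_))
    have := congrArg (fun h => h.1.left.leafEquiv x) hff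
    exact this

end Rep

/-! ### Finiteness and enumeration of trees and representatives -/

/-- Plane binary trees with `n` leaves. -/
abbrev PlaneTree (n : ℕ) : Type := {t : BinaryTree Unit // t.numLeaves = n}

instance (n : ℕ) : Finite (PlaneTree n) := by
  refine Finite.of_injective
    (fun t => (⟨t.1, ?_⟩ : {t // t ∈ BinaryTree.treesOfNumNodesEq (n - 1)})) ?_
  · rw [BinaryTree.mem_treesOfNumNodesEq]
    have := t.1.numLeaves_eq_numNodes_succ
    have := t.2
    omega
  · intro s t h
    exact Subtype.ext (congrArg (fun x => x.1) h)

noncomputable instance (n : ℕ) : Fintype (PlaneTree n) := Fintype.ofFinite _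

theorem sum_planeTree {M : Type*} [AddCommMonoid M] (n : ℕ) (f : BinaryTree Unit → M) :
    ∑ t : PlaneTree (n + 1), f t.1 = ∑ t ∈ BinaryTree.treesOfNumNodesEq n, f t := by
  refine (Finset.sum_subtype _ (fun t => ?_) f).symm
  rw [BinaryTree.mem_treesOfNumNodesEq, t.numLeaves_eq_numNodes_succ, add_left_inj]

theorem card_planeTree (n : ℕ) : Fintype.card (PlaneTree (n + 1)) = catalan n := by
  rw [← BinaryTree.treesOfNumNodesEq_card_eq_catalan, Finset.card_eq_sum_ones, ← sum_planeTree]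
  simp

/-- A representative is a pair of trees with a matching. -/
def repEquiv (n : ℕ) : Rep n ≃ Σ p : PlaneTree n × PlaneTree n, (Leaf p.1.1 ≃ Leaf p.2.1) where
  toFun X := ⟨(⟨X.left, X.left_size⟩, ⟨X.right, X.right_size⟩), X.matching⟩
  invFun Y := ⟨Y.1.1.1, Y.1.2.1, Y.1.1.2, Y.1.2.2, Y.2⟩
  left_inv _ := rfl
  right_inv _ := rfl

instance (n : ℕ) : Finite (Rep n) := Finite.of_equiv _ (repEquiv n).symm

noncomputable instance (n : ℕ) : Fintype (Rep n) := Fintype.ofFinite _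

noncomputable instance (n : ℕ) : Fintype (Tanglegram n) :=
  @Fintype.ofFinite _ (inferInstanceAs (Finite (Quotient (repSetoid n))))

/-! ### Tanglegrams as representatives weighted by automorphisms -/

section Orbits

variable {n : ℕ}

/-- An isomorphism from a representative is a pair of tree isomorphisms. -/
def sigmaIsoEquiv (X : Rep n) :
    (Σ Y, Iso X Y) ≃ (Σ t, RootedIso X.left t) × (Σ t, RootedIso X.right t) where
  toFun f := (⟨_, f.2.left⟩, ⟨_, f.2.right⟩)
  invFun e := ⟨⟨e.1.1, e.2.1,
      by rw [← card_leaf, ← Fintype.card_congr e.1.2.leafEquiv, card_leaf, X.left_size],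
      by rw [← card_leaf, ← Fintype.card_congr e.2.2.leafEquiv, card_leaf, X.right_size],
      (e.1.2.leafEquiv.symm.trans X.matching).trans e.2.2.leafEquiv⟩, e.1.2, e.2.2, fun x => by simp⟩
  left_inv := by
    rintro ⟨⟨s, t, hs, ht, σ⟩, (e : RootedIso X.left s), (f : RootedIso X.right t), h⟩
    have hσ : (e.leafEquiv.symm.trans X.matching).trans f.leafEquiv = σ := by
      ext x
      obtain ⟨x, rfl⟩ := e.leafEquiv.surjective x
      simpa using h x
    subst hσ
    rfl
  right_inv _ := rfl

/-- The matching of the target is forced by the two tree isomorphisms, which can be chosen freely.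
-/
theorem card_sigma_iso (X : Rep n) : Nat.card (Σ Y, Iso X Y) = 4 ^ (n - 1) := by
  have h : ∀ s, Nat.card (Σ t, RootedIso s t) = 2 ^ (s.numLeaves - 1) := fun s => by
    rw [← (TreeIso.finite_and_card_sigma s).2]
    exact Nat.card_congr (Equiv.sigmaCongrRight fun t => (TreeIso.equivRooted s t).symm)
  rw [Nat.card_congr (sigmaIsoEquiv X), Nat.card_prod, h, h, X.left_size, X.right_size, ← mul_pow]
  norm_num

theorem card_iso {X Y : Rep n} (f : Iso X Y) : Nat.card (Iso X Y) = X.numAut := by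
  refine Nat.card_congr ⟨fun g => g.trans f.symm, fun g => g.trans f,
    fun g => Iso.ext_left (Equiv.ext fun x => ?_), fun g => Iso.ext_left (Equiv.ext fun x => ?_)⟩
  · exact f.left.leafEquiv.apply_symm_apply (g.left.leafEquiv x)
  · exact f.left.leafEquiv.symm_apply_apply (g.left.leafEquiv x)

open Classical in
-- Orbit-stabilizer: each member of the class is the target of `X.numAut` isomorphisms from `X`.
theorem card_class_mul_numAut (X : Rep n) :
    Fintype.card {Y : Rep n // (⟦Y⟧ : Quotient (repSetoid n)) = ⟦X⟧} * X.numAut = 4 ^ (n - 1) := by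
  rw [← card_sigma_iso X, Nat.card_sigma, Fintype.card_subtype, Finset.card_eq_sum_ones,
    Finset.sum_mul, Finset.sum_filter]
  refine Finset.sum_congr rfl fun Y _ => ?_
  split_ifs with h
  · obtain ⟨f⟩ : Nonempty (Iso Y X) := Quotient.exact h
    rw [one_mul, card_iso f.symm]
  · have : IsEmpty (Iso X Y) := ⟨fun f => h (Quotient.sound ⟨f.symm⟩)⟩
    simp

/-- The tanglegram of a representative. -/
def Rep.toTanglegram (X : Rep n) : Tanglegram n := Quotient.mk (repSetoid n) X

open Classical in
/-- The number of tanglegrams is a weighted number of representatives. -/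
theorem card_tanglegram (E : Tanglegram n → Prop) :
    4 ^ (n - 1) * Nat.card {T : Tanglegram n // E T} =
      ∑ X : Rep n with E X.toTanglegram, X.numAut := by
  rw [Nat.card_eq_fintype_card, Fintype.card_subtype, Finset.card_eq_sum_ones, Finset.mul_sum,
    Finset.sum_filter, Finset.sum_filter, ← Fintype.sum_fiberwise (Rep.toTanglegram (n := n))]
  refine Finset.sum_congr rfl fun T _ => ?_
  obtain ⟨X, rfl⟩ : ∃ X : Rep n, X.toTanglegram = T := Quotient.exists_rep T
  have h1 : ∀ Y : {Y : Rep n // Y.toTanglegram = X.toTanglegram},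
      (if E Y.1.toTanglegram then Y.1.numAut else 0) =
      if E X.toTanglegram then X.numAut else 0 := by
    rintro ⟨Y, hY⟩
    obtain ⟨f⟩ : Nonempty (Iso Y X) := Quotient.exact hY
    simp only [hY, Rep.numAut_eq f]
  rw [Fintype.sum_congr _ _ h1]
  split_ifs with h
  · rw [mul_one, ← card_class_mul_numAut X, Finset.sum_const, Finset.card_univ, smul_eq_mul]
    congr 1
    exact Fintype.card_congr (Equiv.refl _)
  · simp

end Orbits

/-! ### Intertwining bijections and centralizers -/

section Permutations

variable {α β : Type*}

/-- Two intertwiners differ by an element of the centralizer of `a`. -/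
theorem card_semiconj {a : Equiv.Perm α} {b : Equiv.Perm β} {σ : α ≃ β}
    (h : ∀ x, b (σ x) = σ (a x)) :
    Nat.card {τ : α ≃ β // ∀ x, b (τ x) = τ (a x)} = Nat.card (Subgroup.centralizer {a}) := by
  refine Nat.card_congr ⟨fun τ => ⟨τ.1.trans σ.symm, ?_⟩, fun g => ⟨g.1.trans σ, fun x => ?_⟩,
    fun τ => ?_, fun g => ?_⟩
  · rw [Subgroup.mem_centralizer_singleton_iff]
    ext x
    simp only [Equiv.Perm.mul_apply, Equiv.trans_apply]
    rw [← τ.2, Equiv.symm_apply_eq, ← h, Equiv.apply_symm_apply]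
  · have hg := Equiv.congr_fun (Subgroup.mem_centralizer_singleton_iff.1 g.2) x
    simp only [Equiv.Perm.mul_apply] at hg
    rw [Equiv.trans_apply, Equiv.trans_apply, h, hg]
  · ext x
    simp
  · ext x
    simp

variable [Fintype α] [Fintype β] [DecidableEq α] [DecidableEq β]

theorem card_support_eq_of_semiconj {a : Equiv.Perm α} {b : Equiv.Perm β} {σ : α ≃ β}
    (h : ∀ x, b (σ x) = σ (a x)) : b.support.card = a.support.card := by
  symm
  refine Finset.card_equiv σ fun x => ?_
  rw [Equiv.Perm.mem_support, Equiv.Perm.mem_support, h, σ.injective.ne_iff]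

theorem prod_factorial_count_le (m : Multiset ℕ) :
    ∏ i ∈ m.toFinset, (m.count i).factorial ≤ m.card.factorial := by
  rw [← Multiset.toFinset_sum_count_eq]
  exact Nat.le_of_dvd (Nat.factorial_pos _) (Nat.prod_factorial_dvd_factorial_sum _ _)

theorem prod_le_two_pow_sum (m : Multiset ℕ) : m.prod ≤ 2 ^ m.sum := by
  induction m using Multiset.induction with
  | empty => simp
  | cons a m ih =>
    rw [Multiset.prod_cons, Multiset.sum_cons, pow_add]
    exact Nat.mul_le_mul Nat.lt_two_pow_self.le ih

/-- The order is the factorial of the number of fixed points, times the product of the cycle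
lengths, times the factorials of their multiplicities. The lengths add up to `2 * j`, so their
product is at most `2 ^ (2 * j)`, and there are at most `j` cycles. -/
theorem card_centralizer_le (a : Equiv.Perm α) {j : ℕ} (hj : a.support.card = 2 * j) :
    Nat.card (Subgroup.centralizer {a}) ≤
      (Fintype.card α - 2 * j).factorial * 4 ^ j * j.factorial := by
  rw [Equiv.Perm.nat_card_centralizer, Equiv.Perm.sum_cycleType, hj]
  have h1 := prod_le_two_pow_sum a.cycleType
  rw [Equiv.Perm.sum_cycleType, hj, pow_mul] at h1
  have h2 : a.cycleType.card ≤ j := by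
    have := Multiset.card_nsmul_le_sum (s := a.cycleType) (a := 2)
      fun x hx => Equiv.Perm.two_le_of_mem_cycleType hx
    rw [Equiv.Perm.sum_cycleType, hj, smul_eq_mul] at this
    omega
  gcongr
  · exact h1
  · exact (prod_factorial_count_le _).trans (Nat.factorial_le h2)

theorem cycleType_of_involutive {a : Equiv.Perm α} (ha : ∀ x, a (a x) = x) {j : ℕ}
    (hj : a.support.card = 2 * j) : a.cycleType = Multiset.replicate j 2 := by
  have h1 : ∀ c ∈ a.cycleType, c = 2 := by
    refine (Equiv.Perm.pow_prime_eq_one_iff (p := 2)).1 ?_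
    ext x
    simp [pow_two, ha]
  have h2 := Multiset.eq_replicate_card.2 h1
  rw [h2]
  congr 1
  have := Equiv.Perm.sum_cycleType a
  rw [h2, Multiset.sum_replicate, hj, smul_eq_mul] at this
  omega

/-- Involutions with equally many transpositions are conjugate, so an intertwiner exists, and the
centralizer formula is exact for `j` cycles of length `2`. -/
theorem card_semiconj_involutive {a : Equiv.Perm α} {b : Equiv.Perm β}
    (hc : Fintype.card α = Fintype.card β) (ha : ∀ x, a (a x) = x) (hb : ∀ x, b (b x) = x) {j : ℕ}
    (haj : a.support.card = 2 * j) (hbj : b.support.card = 2 * j) :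
    Nat.card {τ : α ≃ β // ∀ x, b (τ x) = τ (a x)} =
      (Fintype.card α - 2 * j).factorial * 2 ^ j * j.factorial := by
  let φ := Fintype.equivOfCardEq hc
  let c : Equiv.Perm β := φ.permCongr a
  have hφ : ∀ x, c (φ x) = φ (a x) := fun x => by simp [c, Equiv.permCongr_apply]
  have hcc : ∀ x, c (c x) = x := fun x => by
    obtain ⟨x, rfl⟩ := φ.surjective x
    rw [hφ, hφ, ha]
  have hcj : c.support.card = 2 * j := by rw [card_support_eq_of_semiconj hφ, haj]
  have hconj : IsConj c b := Equiv.Perm.isConj_iff_cycleType_eq.2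
    ((cycleType_of_involutive hcc hcj).trans (cycleType_of_involutive hb hbj).symm)
  obtain ⟨g, hg⟩ := isConj_iff.1 hconj
  have hσ : ∀ x, b ((φ.trans g) x) = (φ.trans g) (a x) := fun x => by
    rw [← hg]
    simp [← hφ]
  rw [card_semiconj hσ, Equiv.Perm.nat_card_centralizer, Equiv.Perm.sum_cycleType, haj,
    cycleType_of_involutive ha haj]
  rcases j.eq_zero_or_pos with rfl | hj
  · simp
  · rw [Multiset.toFinset_replicate, if_neg hj.ne']
    simp

end Permutations

/-! ### Double counting of matchings and pairs of tree automorphisms -/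

instance (s t : BinaryTree Unit) : Finite (RootedIso s t) :=
  Finite.of_equiv _ (TreeIso.equivRooted s t)

noncomputable instance (s t : BinaryTree Unit) : Fintype (RootedIso s t) := Fintype.ofFinite _

noncomputable instance (s t : BinaryTree Unit) : Fintype (Leaf s ≃ Leaf t) := Fintype.ofFinite _

/-- The number of matchings with which a pair of tree automorphisms is compatible. -/
noncomputable def numCompat {s t : BinaryTree Unit} (e : TreeIso s s) (f : TreeIso t t) : ℕ :=
  Nat.card {σ : Leaf s ≃ Leaf t //
    ∀ x, f.toRooted.leafEquiv (σ x) = σ (e.toRooted.leafEquiv x)}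

open Classical in
-- Reorders the choices: tree automorphisms come before the matching, so what remains is to count
-- matchings that intertwine two given permutations.
theorem sum_card_iso (n : ℕ) (P : ∀ {s t : BinaryTree Unit}, RootedIso s s → RootedIso t t → Prop) :
    ∑ X : Rep n, Nat.card {f : Iso X X // P f.left f.right} =
      ∑ s : PlaneTree n, ∑ t : PlaneTree n, ∑ e : TreeIso s.1 s.1, ∑ f : TreeIso t.1 t.1,
        if P e.toRooted f.toRooted then numCompat e f else 0 := by
  rw [← (repEquiv n).symm.sum_comp, Fintype.sum_sigma, Fintype.sum_prod_type]
  refine Finset.sum_congr rfl fun s _ => Finset.sum_congr rfl fun t _ => ?_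
  let Z : (Leaf s.1 ≃ Leaf t.1) → Rep n := fun σ => ⟨s.1, t.1, s.2, t.2, σ⟩
  let E : (Σ σ : Leaf s.1 ≃ Leaf t.1, {f : Iso (Z σ) (Z σ) // P f.left f.right}) ≃
      Σ e : RootedIso s.1 s.1, Σ f : RootedIso t.1 t.1, {σ : Leaf s.1 ≃ Leaf t.1 //
        P e f ∧ ∀ x, f.leafEquiv (σ x) = σ (e.leafEquiv x)} :=
    { toFun := fun y => ⟨y.2.1.left, y.2.1.right, y.1, y.2.2, y.2.1.matching⟩
      invFun := fun y => ⟨y.2.2.1, ⟨⟨y.1, y.2.1, y.2.2.2.2⟩, y.2.2.2.1⟩⟩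
      left_inv := fun _ => rfl
      right_inv := fun _ => rfl }
  change ∑ σ : Leaf s.1 ≃ Leaf t.1, Nat.card {f : Iso (Z σ) (Z σ) // P f.left f.right} = _
  rw [← Nat.card_sigma, Nat.card_congr E, Nat.card_sigma, ← (TreeIso.equivRooted _ _).sum_comp]
  refine Finset.sum_congr rfl fun e _ => ?_
  rw [Nat.card_sigma, ← (TreeIso.equivRooted _ _).sum_comp]
  refine Finset.sum_congr rfl fun f _ => ?_
  simp only [TreeIso.equivRooted_apply]
  split_ifs with h
  · simp only [h, true_and]
    rfl
  · simp [h]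

section Compat

variable {s t : BinaryTree Unit} {e : TreeIso s s} {f : TreeIso t t}

theorem numMoved_eq_of_numCompat_ne_zero (h : numCompat e f ≠ 0) : f.numMoved = e.numMoved := by
  classical
  obtain ⟨⟨σ, hσ⟩⟩ := (Nat.card_ne_zero.1 h).1
  rw [← TreeIso.card_support, ← TreeIso.card_support]
  exact card_support_eq_of_semiconj hσ

theorem numCompat_le {j : ℕ} (hj : e.numMoved = 2 * j) :
    numCompat e f ≤ (s.numLeaves - 2 * j).factorial * 4 ^ j * j.factorial := by
  classical
  by_cases h : numCompat e f = 0
  · rw [h]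
    exact Nat.zero_le _
  · obtain ⟨⟨σ, hσ⟩⟩ := (Nat.card_ne_zero.1 h).1
    refine (card_semiconj hσ).le.trans ?_
    rw [← card_leaf]
    exact card_centralizer_le _ (by rw [← hj, ← TreeIso.card_support])

theorem numCompat_of_isCherryAut (hst : s.numLeaves = t.numLeaves)
    (he : e.toRooted.IsCherryAut) (hf : f.toRooted.IsCherryAut) {j : ℕ}
    (hej : e.numMoved = 2 * j) (hfj : f.numMoved = 2 * j) :
    numCompat e f = (s.numLeaves - 2 * j).factorial * 2 ^ j * j.factorial := by
  classical
  rw [← card_leaf]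
  refine card_semiconj_involutive ?_ he.apply_apply hf.apply_apply ?_ ?_
  · rw [card_leaf, card_leaf, hst]
  · rw [← hej, ← TreeIso.card_support]
  · rw [← hfj, ← TreeIso.card_support]

theorem numMoved_le (e : TreeIso s s) : e.numMoved ≤ s.numLeaves := by
  classical
  rw [← TreeIso.card_support, ← card_leaf]
  exact Finset.card_le_univ _

end Compat

/-- The number of automorphisms of trees of size `n` that interchange the leaves of `j` cherries and
fix all other leaves. -/
noncomputable def numCherryAut (n j : ℕ) : ℕ :=
  ∑ t : PlaneTree n, Finset.card {e : TreeIso t.1 t.1 | e.numMoved = 2 * j ∧ e.numSwaps = j}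

/-- The factorial moments of the number of matched cherries. -/
theorem sum_choose_numMatchedCherries (n j : ℕ) :
    ∑ X : Rep n, X.numMatchedCherries.choose j =
      numCherryAut n j ^ 2 * ((n - 2 * j).factorial * 2 ^ j * j.factorial) := by
  classical
  have h1 : ∀ X : Rep n, X.numMatchedCherries.choose j = Nat.card {f : Iso X X //
      (f.left.IsCherryAut ∧ f.right.IsCherryAut) ∧
        Finset.card (Equiv.Perm.support (f.left.leafEquiv : Equiv.Perm (Leaf X.left))) = 2 * j} := by
    intro X
    simp_rw [← Rep.card_induced_support, Rep.isInduced_iff]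
  simp_rw [h1]
  rw [sum_card_iso n fun {s t} e f => (e.IsCherryAut ∧ f.IsCherryAut) ∧
        Finset.card (Equiv.Perm.support (e.leafEquiv : Equiv.Perm (Leaf s))) = 2 * j]
  rw [numCherryAut, pow_two, Finset.sum_mul_sum, Finset.sum_mul]
  refine Finset.sum_congr rfl fun s _ => ?_
  rw [Finset.sum_mul]
  refine Finset.sum_congr rfl fun t _ => ?_
  rw [Finset.card_eq_sum_ones, Finset.card_eq_sum_ones, Finset.sum_filter, Finset.sum_filter,
    Finset.sum_mul_sum, Finset.sum_mul]
  refine Finset.sum_congr rfl fun e _ => ?_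
  rw [Finset.sum_mul]
  refine Finset.sum_congr rfl fun f _ => ?_
  rw [TreeIso.card_support]
  have hst : s.1.numLeaves = t.1.numLeaves := s.2.trans t.2.symm
  by_cases he : e.numMoved = 2 * j ∧ e.numSwaps = j
  · have he' : e.toRooted.IsCherryAut := e.isCherryAut_iff.2 (by rw [he.1, he.2])
    by_cases hf : f.numMoved = 2 * j ∧ f.numSwaps = j
    · have hf' : f.toRooted.IsCherryAut := f.isCherryAut_iff.2 (by rw [hf.1, hf.2])
      rw [if_pos ⟨⟨he', hf'⟩, he.1⟩, if_pos he, if_pos hf, one_mul, one_mul,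
        numCompat_of_isCherryAut hst he' hf' he.1 hf.1, s.2]
    · rw [if_pos he, if_neg hf, mul_zero, zero_mul]
      split_ifs with h
      -- A compatible `f` moves as many leaves as `e`, so as a cherry automorphism it would have
      -- exactly `j` exchanges, contrary to `hf`.
      · by_contra h0
        have h2 := numMoved_eq_of_numCompat_ne_zero h0
        have h3 := f.isCherryAut_iff.1 h.1.2
        omega
      · rfl
  · rw [if_neg he, if_neg, zero_mul, zero_mul]
    rintro ⟨⟨h2, -⟩, h3⟩
    rw [TreeIso.isCherryAut_iff] at h2
    omega

/-! ### Exponential bounds for moments and for automorphisms that are not induced -/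

section Bounds

/-- Passing from `m` to `m + 1` costs `(1 + 1 / m) ^ k`, which is at most `e` because `k ≤ m`. -/
theorem pow_mul_factorial_le {n k : ℕ} (h : k ≤ n) :
    (n : ℝ) ^ k * (n - k).factorial ≤ Real.exp 1 ^ k * n.factorial := by
  induction k generalizing n with
  | zero => simp
  | succ k ih =>
    obtain ⟨m, rfl⟩ : ∃ m, n = m + 1 := ⟨n - 1, by omega⟩
    have hk : k ≤ m := by omega
    have h1 : ((m + 1 : ℕ) : ℝ) ^ k ≤ Real.exp 1 * (m : ℝ) ^ k := by
      rcases m.eq_zero_or_pos with rfl | hm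
      · obtain rfl : k = 0 := by omega
        simp
      · have hm' : (0 : ℝ) < m := by exact_mod_cast hm
        have h2 : ((m + 1 : ℕ) : ℝ) = (1 / m + 1) * m := by
          push_cast
          field_simp
          ring
        rw [h2, mul_pow]
        gcongr
        calc (1 / (m : ℝ) + 1) ^ k ≤ (Real.exp (1 / m)) ^ k := by
              gcongr
              exact Real.add_one_le_exp _
          _ = Real.exp (k * (1 / m)) := (Real.exp_nat_mul _ _).symm
          _ ≤ Real.exp 1 := by
              rw [Real.exp_le_exp, mul_one_div, div_le_one hm']
              exact_mod_cast hk
    rw [Nat.add_sub_add_right, pow_succ, pow_succ, Nat.factorial_succ]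
    calc ((m + 1 : ℕ) : ℝ) ^ k * ((m + 1 : ℕ) : ℝ) * (m - k).factorial
        ≤ (Real.exp 1 * (m : ℝ) ^ k) * ((m + 1 : ℕ) : ℝ) * (m - k).factorial := by gcongr
      _ = Real.exp 1 * ((m + 1 : ℕ) : ℝ) * ((m : ℝ) ^ k * (m - k).factorial) := by ring
      _ ≤ Real.exp 1 * ((m + 1 : ℕ) : ℝ) * (Real.exp 1 ^ k * m.factorial) := by
          exact mul_le_mul_of_nonneg_left (ih hk) (by positivity)
      _ = _ := by
          push_cast
          ring

/-- A Markov-type bound from `TreeIso.sum_weight_le`: every counted automorphism has weight at least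
`x ^ i * 4 ^ (-j)`. The choice `x = j / n` makes the total weight at most `(1 + x) ^ n ≤ e ^ j`. -/
theorem card_numMoved_le (t : BinaryTree Unit) {i j : ℕ} (hij : i ≤ j) (hj : 2 * j ≤ t.numLeaves) :
    (Finset.card {f : TreeIso t t | f.numMoved = 2 * j ∧ f.numSwaps ≤ i} : ℝ) ≤
      (4 * Real.exp 1) ^ j * (t.numLeaves / j : ℝ) ^ i := by
  have hn : (0 : ℝ) < t.numLeaves := by exact_mod_cast t.numLeaves_pos
  set n := t.numLeaves with hn_def
  set x : ℝ := j / n with hx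
  have hx0 : 0 ≤ x := by positivity
  have hx1 : x ≤ 1 := by
    rw [hx, div_le_one hn]
    exact_mod_cast (show j ≤ n by omega)
  -- For `j = 0` also `x = 0`, but then `i = 0` and the power is `1`.
  have hpos : 0 < x ^ i := by
    rcases j.eq_zero_or_pos with rfl | hj0
    · obtain rfl : i = 0 := by omega
      simp
    · positivity
  have h1 : (Finset.card {f : TreeIso t t | f.numMoved = 2 * j ∧ f.numSwaps ≤ i} : ℝ) *
      (x ^ i * (1 / 4) ^ j) ≤ Real.exp 1 ^ j := by
    calc _ = ∑ f : TreeIso t t with f.numMoved = 2 * j ∧ f.numSwaps ≤ i, x ^ i * (1 / 4) ^ j := by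
          rw [Finset.sum_const, nsmul_eq_mul]
      _ ≤ ∑ f : TreeIso t t with f.numMoved = 2 * j ∧ f.numSwaps ≤ i,
            x ^ f.numSwaps * (1 / 2) ^ f.numMoved := by
          refine Finset.sum_le_sum fun f hf => ?_
          obtain ⟨-, hf1, hf2⟩ := Finset.mem_filter.1 hf
          rw [hf1, pow_mul]
          norm_num only
          gcongr ?_ * _
          exact pow_le_pow_of_le_one hx0 hx1 hf2
      _ ≤ ∑ f : TreeIso t t, x ^ f.numSwaps * (1 / 2) ^ f.numMoved :=
          Finset.sum_le_sum_of_subset_of_nonneg (Finset.filter_subset _ _)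
            fun _ _ _ => by positivity
      _ ≤ (1 + x) ^ (n - 1) := TreeIso.sum_weight_le t hx0
      _ ≤ (1 + x) ^ n := pow_le_pow_right₀ (by linarith) (Nat.sub_le _ _)
      _ ≤ Real.exp x ^ n := by
          gcongr
          rw [add_comm]
          exact Real.add_one_le_exp x
      _ = Real.exp 1 ^ j := by
          rw [← Real.exp_nat_mul, ← Real.exp_nat_mul, hx, mul_div_cancel₀ _ hn.ne', mul_one]
  have h2 : (n / j : ℝ) ^ i = (x ^ i)⁻¹ := by rw [hx, ← inv_pow, inv_div]
  rw [h2, ← div_eq_mul_inv, le_div_iff₀ hpos, mul_pow]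
  have h3 : (4 : ℝ) ^ j * (1 / 4) ^ j = 1 := by rw [← mul_pow]; norm_num
  calc _ = 4 ^ j * ((Finset.card {f : TreeIso t t | f.numMoved = 2 * j ∧ f.numSwaps ≤ i} : ℝ) *
      (x ^ i * (1 / 4) ^ j)) := by
        linear_combination (-(Finset.card {f : TreeIso t t | f.numMoved = 2 * j ∧ f.numSwaps ≤ i} : ℝ) *
          x ^ i) * h3
    _ ≤ _ := by gcongr

theorem factorial_mul_inv_pow_le (j : ℕ) :
    (j.factorial : ℝ) * ((j : ℝ)⁻¹) ^ (2 * j) ≤ 1 / j.factorial := by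
  rcases j.eq_zero_or_pos with rfl | hj
  · simp
  · have h : (j.factorial : ℝ) ≤ (j : ℝ) ^ j := by exact_mod_cast Nat.factorial_le_pow j
    have hj' : (0 : ℝ) < j := by exact_mod_cast hj
    rw [le_div_iff₀ (by positivity), inv_pow, two_mul, pow_add, mul_inv]
    calc _ ≤ (j : ℝ) ^ j * (((j : ℝ) ^ j)⁻¹ * ((j : ℝ) ^ j)⁻¹) * (j : ℝ) ^ j := by gcongr
      _ = 1 := by field_simp

/-- The base of the exponential bounds. -/
noncomputable def expBase : ℝ := 64 * Real.exp 1 ^ 4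

theorem expBase_pos : 0 < expBase := by unfold expBase; positivity

/-- The powers of `n` are absorbed by `(n - 2 * j)!` at a cost of `e ^ (2 * j)`, and `j! * j ^ (-2 *
j)` is at most `1 / j!`. The base is `e ^ 2 * 4 * (4 * e) ^ 2 = 64 * e ^ 4`. -/
theorem factorial_mul_le {n j : ℕ} (hj : 2 * j ≤ n) :
    ((n - 2 * j).factorial * 4 ^ j * j.factorial : ℝ) *
      ((4 * Real.exp 1) ^ j * (n / j : ℝ) ^ j) ^ 2 ≤ n.factorial * (expBase ^ j / j.factorial) := by
  have h1 := pow_mul_factorial_le hj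
  have h2 := factorial_mul_inv_pow_le j
  calc _ = ((n : ℝ) ^ (2 * j) * (n - 2 * j).factorial) *
        (j.factorial * ((j : ℝ)⁻¹) ^ (2 * j)) * (4 ^ j * ((4 * Real.exp 1) ^ j) ^ 2) := by
        rw [div_eq_mul_inv]
        ring
    _ ≤ (Real.exp 1 ^ (2 * j) * n.factorial) * (1 / j.factorial) *
        (4 ^ j * ((4 * Real.exp 1) ^ j) ^ 2) := by gcongr
    _ = n.factorial * ((Real.exp 1 ^ (2 * j) * (4 ^ j * ((4 * Real.exp 1) ^ j) ^ 2)) /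
        j.factorial) := by ring
    _ = _ := by
        have : Real.exp 1 ^ (2 * j) * (4 ^ j * ((4 * Real.exp 1) ^ j) ^ 2) = expBase ^ j := by
          rw [expBase, ← pow_mul, mul_comm j 2, pow_mul, pow_mul, ← mul_pow, ← mul_pow]
          congr 1
          ring
        rw [this]

end Bounds

theorem numCherryAut_le {n j : ℕ} (hj : 2 * j ≤ n) :
    (numCherryAut n j : ℝ) ≤ Fintype.card (PlaneTree n) * ((4 * Real.exp 1) ^ j * (n / j : ℝ) ^ j) := by
  rw [numCherryAut, Nat.cast_sum, ← nsmul_eq_mul, ← Finset.card_univ, ← Finset.sum_const]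
  refine Finset.sum_le_sum fun t _ => ?_
  have h := card_numMoved_le t.1 le_rfl (t.2.symm ▸ hj)
  rw [t.2] at h
  refine le_trans ?_ h
  exact Nat.cast_le.2 (Finset.card_le_card
    (Finset.monotone_filter_right _ fun f _ hf => ⟨hf.1, hf.2.le⟩))

theorem numCherryAut_eq_zero {n j : ℕ} (hj : n < 2 * j) : numCherryAut n j = 0 := by
  refine Finset.sum_eq_zero fun t _ => ?_
  rw [Finset.card_eq_zero, Finset.filter_eq_empty_iff]
  rintro e - ⟨he, -⟩
  have := numMoved_le e
  have := t.2
  omega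

/-- A uniform bound for the factorial moments of the number of matched cherries. -/
theorem moment_le (n j : ℕ) :
    (numCherryAut n j ^ 2 * ((n - 2 * j).factorial * 2 ^ j * j.factorial) : ℝ) ≤
      Fintype.card (PlaneTree n) ^ 2 * n.factorial * (expBase ^ j / j.factorial) := by
  have := expBase_pos
  rcases lt_or_ge n (2 * j) with h | h
  · rw [numCherryAut_eq_zero h]
    norm_num
    positivity
  · calc _ ≤ (Fintype.card (PlaneTree n) * ((4 * Real.exp 1) ^ j * (n / j : ℝ) ^ j)) ^ 2 *
          ((n - 2 * j).factorial * 4 ^ j * j.factorial) := by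
          gcongr
          · exact numCherryAut_le h
          · norm_num
      _ = Fintype.card (PlaneTree n) ^ 2 * (((n - 2 * j).factorial * 4 ^ j * j.factorial : ℝ) *
          ((4 * Real.exp 1) ^ j * (n / j : ℝ) ^ j) ^ 2) := by ring
      _ ≤ _ := by
          rw [mul_assoc (_ ^ 2) (n.factorial : ℝ)]
          exact mul_le_mul_of_nonneg_left (factorial_mul_le h) (by positivity)

/-- The number of automorphisms that move `2 * j` leaves. -/
noncomputable def countMoved (t : BinaryTree Unit) (j : ℕ) : ℕ :=
  Finset.card {f : TreeIso t t | f.numMoved = 2 * j}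

/-- The number of automorphisms that move `2 * j` leaves and do not only interchange the leaves of
cherries. -/
noncomputable def countOther (t : BinaryTree Unit) (j : ℕ) : ℕ :=
  Finset.card {f : TreeIso t t | f.numMoved = 2 * j ∧ f.numMoved ≠ 2 * f.numSwaps}

theorem countMoved_le (t : BinaryTree Unit) {j : ℕ} (hj : 2 * j ≤ t.numLeaves) :
    (countMoved t j : ℝ) ≤ (4 * Real.exp 1) ^ j * (t.numLeaves / j : ℝ) ^ j := by
  refine le_trans ?_ (card_numMoved_le t le_rfl hj)
  refine Nat.cast_le.2 (Finset.card_le_card (Finset.monotone_filter_right _ fun f _ hf => ⟨hf, ?_⟩))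
  have := f.two_mul_numSwaps_le
  omega

/-- An automorphism counted here has fewer than `j` topmost exchanges, so `card_numMoved_le` applies
with `i = j - 1` and saves one factor `n / j`. -/
theorem countOther_le (t : BinaryTree Unit) {j : ℕ} (hj : 2 * j ≤ t.numLeaves) :
    (countOther t j : ℝ) ≤ (4 * Real.exp 1) ^ j * (t.numLeaves / j : ℝ) ^ j * (j / t.numLeaves) := by
  have hn : (0 : ℝ) < t.numLeaves := by exact_mod_cast t.numLeaves_pos
  -- For `j = 0` the right-hand side is `0`, so the count has to vanish.
  rcases j with _ | j
  · have : countOther t 0 = 0 := by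
      rw [countOther, Finset.card_eq_zero, Finset.filter_eq_empty_iff]
      rintro f - ⟨h1, h2⟩
      have := f.two_mul_numSwaps_le
      omega
    rw [this]
    simp
  · have h1 : (4 * Real.exp 1) ^ (j + 1) * (t.numLeaves / (j + 1 : ℕ) : ℝ) ^ (j + 1) *
        ((j + 1 : ℕ) / t.numLeaves) =
        (4 * Real.exp 1) ^ (j + 1) * (t.numLeaves / (j + 1 : ℕ) : ℝ) ^ j := by
      have hj' : ((j + 1 : ℕ) : ℝ) ≠ 0 := by positivity
      rw [pow_succ (t.numLeaves / (j + 1 : ℕ) : ℝ)]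
      field_simp
    rw [h1]
    refine le_trans ?_ (card_numMoved_le t (Nat.le_succ j) hj)
    refine Nat.cast_le.2 (Finset.card_le_card
      (Finset.monotone_filter_right _ fun f _ hf => ⟨hf.1, ?_⟩))
    have := f.two_mul_numSwaps_le
    have := hf.1
    have := hf.2
    omega

theorem countMoved_eq_zero {t : BinaryTree Unit} {j : ℕ} (hj : t.numLeaves < 2 * j) :
    countMoved t j = 0 := by
  rw [countMoved, Finset.card_eq_zero, Finset.filter_eq_empty_iff]
  rintro e - he
  have := numMoved_le e
  omega

theorem mul_countOther_mul_countMoved_le {n : ℕ} (s t : PlaneTree n) (j : ℕ) :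
    ((n - 2 * j).factorial * 4 ^ j * j.factorial : ℝ) * (countOther s.1 j * countMoved t.1 j) ≤
      n.factorial / n * ((2 * expBase) ^ j / j.factorial) := by
  have hB := expBase_pos
  rcases lt_or_ge n (2 * j) with h | h
  · rw [countMoved_eq_zero (t.2.symm ▸ h)]
    norm_num
    positivity
  · have h1 := countOther_le s.1 (s.2.symm ▸ h)
    have h2 := countMoved_le t.1 (t.2.symm ▸ h)
    rw [s.2] at h1
    rw [t.2] at h2
    -- Absorbs the `j` of the saved factor `j / n`, hence the base `2 * expBase`.
    have h3 : (j : ℝ) ≤ 2 ^ j := by exact_mod_cast Nat.lt_two_pow_self.le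
    calc _ ≤ ((n - 2 * j).factorial * 4 ^ j * j.factorial : ℝ) *
          (((4 * Real.exp 1) ^ j * (n / j : ℝ) ^ j * (j / n)) *
            ((4 * Real.exp 1) ^ j * (n / j : ℝ) ^ j)) := by gcongr
      _ = (((n - 2 * j).factorial * 4 ^ j * j.factorial : ℝ) *
          ((4 * Real.exp 1) ^ j * (n / j : ℝ) ^ j) ^ 2) * (j / n) := by ring
      _ ≤ (n.factorial * (expBase ^ j / j.factorial)) * (2 ^ j / n) := by
          refine mul_le_mul (factorial_mul_le h) ?_ (by positivity) (by positivity)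
          gcongr
      _ = _ := by
          rw [mul_pow]
          ring

open Classical in
theorem sum_numCompat_le {n : ℕ} (s t : PlaneTree n) :
    ((∑ e : TreeIso s.1 s.1, ∑ f : TreeIso t.1 t.1,
      if ¬ (e.toRooted.IsCherryAut ∧ f.toRooted.IsCherryAut) then numCompat e f else 0 : ℕ) : ℝ) ≤
      n.factorial / n * (2 * Real.exp (2 * expBase)) := by
  have hB := expBase_pos
  let z : ℕ → ℕ := fun j => (n - 2 * j).factorial * 4 ^ j * j.factorial
  -- A compatible pair moves a common even number `2 * j` of leaves on both sides, and one of the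
  -- two is not a cherry automorphism. The two summands cover the two cases.
  have key : ∀ (e : TreeIso s.1 s.1) (f : TreeIso t.1 t.1),
      (if ¬ (e.toRooted.IsCherryAut ∧ f.toRooted.IsCherryAut) then numCompat e f else 0) ≤
      ∑ j ∈ Finset.range (n + 1), z j *
        ((if e.numMoved = 2 * j ∧ e.numMoved ≠ 2 * e.numSwaps then 1 else 0) *
          (if f.numMoved = 2 * j then 1 else 0) +
        (if e.numMoved = 2 * j then 1 else 0) *
          (if f.numMoved = 2 * j ∧ f.numMoved ≠ 2 * f.numSwaps then 1 else 0)) := by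
    intro e f
    by_cases h : e.toRooted.IsCherryAut ∧ f.toRooted.IsCherryAut
    · rw [if_neg (not_not.2 h)]
      exact Nat.zero_le _
    · rw [if_pos h]
      by_cases h0 : numCompat e f = 0
      · rw [h0]
        exact Nat.zero_le _
      obtain ⟨j, hj⟩ := e.even_numMoved
      rw [← two_mul] at hj
      have hfe := numMoved_eq_of_numCompat_ne_zero h0
      have hjn : j ∈ Finset.range (n + 1) := by
        have := numMoved_le e
        have := s.2
        rw [Finset.mem_range]
        omega
      refine le_trans ?_ (Finset.single_le_sum (fun _ _ => Nat.zero_le _) hjn)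
      have h1 : numCompat e f ≤ z j := by
        have := numCompat_le (f := f) hj
        rwa [s.2] at this
      refine h1.trans (Nat.le_mul_of_pos_right _ ?_)
      rw [TreeIso.isCherryAut_iff, TreeIso.isCherryAut_iff, not_and_or] at h
      rcases h with h | h
      · rw [if_pos ⟨hj, h⟩, if_pos (hfe.trans hj)]
        omega
      · rw [if_pos hj, if_pos (show f.numMoved = 2 * j ∧ f.numMoved ≠ 2 * f.numSwaps from
          ⟨hfe.trans hj, h⟩)]
        omega
  have h2 : (∑ e : TreeIso s.1 s.1, ∑ f : TreeIso t.1 t.1,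
      if ¬ (e.toRooted.IsCherryAut ∧ f.toRooted.IsCherryAut) then numCompat e f else 0) ≤
      ∑ j ∈ Finset.range (n + 1), z j *
        (countOther s.1 j * countMoved t.1 j + countMoved s.1 j * countOther t.1 j) := by
    refine (Finset.sum_le_sum fun e _ => Finset.sum_le_sum fun f _ => key e f).trans (le_of_eq ?_)
    simp_rw [countOther, countMoved, Finset.card_eq_sum_ones, Finset.sum_filter,
      Finset.sum_mul_sum, ← Finset.sum_add_distrib, Finset.mul_sum]
    rw [Finset.sum_congr rfl fun e _ => Finset.sum_comm, Finset.sum_comm]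
  calc _ ≤ ((∑ j ∈ Finset.range (n + 1), z j *
        (countOther s.1 j * countMoved t.1 j + countMoved s.1 j * countOther t.1 j) : ℕ) : ℝ) :=
        Nat.cast_le.2 h2
    _ ≤ ∑ j ∈ Finset.range (n + 1),
          n.factorial / n * 2 * ((2 * expBase) ^ j / j.factorial) := by
        rw [Nat.cast_sum]
        refine Finset.sum_le_sum fun j _ => ?_
        have h3 := mul_countOther_mul_countMoved_le s t j
        have h4 := mul_countOther_mul_countMoved_le t s j
        simp only [z]
        push_cast
        linarith
    _ = n.factorial / n * 2 * ∑ j ∈ Finset.range (n + 1), (2 * expBase) ^ j / j.factorial :=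
        (Finset.mul_sum _ _ _).symm
    _ ≤ n.factorial / n * 2 * Real.exp (2 * expBase) := by
        gcongr
        exact Real.sum_le_exp_of_nonneg (by positivity) _
    _ = _ := by ring

theorem card_rep (n : ℕ) : Fintype.card (Rep n) = Fintype.card (PlaneTree n) ^ 2 * n.factorial := by
  rw [← Nat.card_eq_fintype_card, Nat.card_congr (repEquiv n), Nat.card_sigma,
    Finset.sum_const_nat (m := n.factorial), Finset.card_univ, Fintype.card_prod, pow_two]
  intro p _
  have φ : Leaf p.1.1 ≃ Leaf p.2.1 :=
    Fintype.equivOfCardEq (by rw [card_leaf, card_leaf, p.1.2, p.2.2])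
  rw [Nat.card_congr (Equiv.equivCongr (Equiv.refl _) φ.symm)]
  refine (Nat.card_perm (α := Leaf p.1.1)).trans ?_
  rw [Nat.card_eq_fintype_card, card_leaf, p.1.2]

/-- Few automorphisms of representatives are not induced by matched cherries. -/
theorem sum_card_not_induced_le (n : ℕ) :
    ((∑ X : Rep n, Nat.card {f : Iso X X // ¬ X.IsInduced f} : ℕ) : ℝ) ≤
      Fintype.card (Rep n) * (2 * Real.exp (2 * expBase) / n) := by
  classical
  simp_rw [Rep.isInduced_iff]
  rw [sum_card_iso n fun {s t} e f => ¬ (e.IsCherryAut ∧ f.IsCherryAut), Nat.cast_sum]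
  calc _ ≤ ∑ s : PlaneTree n, ∑ t : PlaneTree n,
        (n.factorial / n * (2 * Real.exp (2 * expBase)) : ℝ) := by
        refine Finset.sum_le_sum fun s _ => ?_
        rw [Nat.cast_sum]
        refine Finset.sum_le_sum fun t _ => le_of_eq_of_le ?_ (sum_numCompat_le s t)
        congr!
    _ = _ := by
        simp only [Finset.sum_const, Finset.card_univ, nsmul_eq_mul, card_rep]
        push_cast
        ring

/-! ### Exact enumeration of sets of cherries by generating functions -/

/-- The generating polynomial of the automorphisms of a tree that interchange the leaves of some
cherries and fix all other leaves. -/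
noncomputable def cherryPoly (t : BinaryTree Unit) : Polynomial ℤ :=
  ∑ e : TreeIso t t, if e.numMoved = 2 * e.numSwaps then Polynomial.X ^ e.numSwaps else 0

theorem coeff_cherryPoly (t : BinaryTree Unit) (j : ℕ) : (cherryPoly t).coeff j =
    Finset.card {e : TreeIso t t | e.numMoved = 2 * j ∧ e.numSwaps = j} := by
  rw [cherryPoly, Polynomial.finsetSum_coeff, Finset.card_eq_sum_ones, Finset.sum_filter,
    Nat.cast_sum]
  refine Finset.sum_congr rfl fun e _ => ?_
  by_cases h : e.numMoved = 2 * e.numSwaps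
  · rw [if_pos h, Polynomial.coeff_X_pow, Nat.cast_ite]
    congr 1
    simp only [eq_iff_iff]
    omega
  · rw [if_neg h, if_neg (by rintro ⟨h1, h2⟩; omega)]
    simp

theorem cherryPoly_nil : cherryPoly nil = 1 := by
  have : ∀ f : TreeIso .nil .nil, f = TreeIso.nil := by rintro ⟨⟩; rfl
  rw [cherryPoly, Fintype.sum_eq_single TreeIso.nil fun f hf => absurd (this f) hf]
  simp [TreeIso.numSwaps, TreeIso.numMoved]

/-- Exchanging the branches at the root is admissible only if the root carries a cherry, and then
contributes a single `X`. -/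
theorem cherryPoly_node (a : Unit) (l r : BinaryTree Unit) : cherryPoly (node a l r) =
    cherryPoly l * cherryPoly r + if l = nil ∧ r = nil then Polynomial.X else 0 := by
  rw [cherryPoly, ← (TreeIso.nodeEquiv a a l r l r).sum_comp, Fintype.sum_sum_type,
    Fintype.sum_prod_type, Fintype.sum_prod_type]
  simp only [TreeIso.nodeEquiv, Equiv.coe_fn_mk, TreeIso.numSwaps, TreeIso.numMoved]
  congr 1
  · rw [cherryPoly, cherryPoly, Finset.sum_mul_sum]
    refine Finset.sum_congr rfl fun f _ => Finset.sum_congr rfl fun g _ => ?_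
    have h1 := f.two_mul_numSwaps_le
    have h2 := g.two_mul_numSwaps_le
    by_cases hf : f.numMoved = 2 * f.numSwaps
    · by_cases hg : g.numMoved = 2 * g.numSwaps
      · rw [if_pos hf, if_pos hg, if_pos (by omega), pow_add]
      · rw [if_neg hg, if_neg (by omega), mul_zero]
    · rw [if_neg hf, if_neg (by omega), zero_mul]
  · split_ifs with h h'
    · obtain ⟨rfl, rfl⟩ := h'
      have : ∀ f : TreeIso .nil .nil, f = TreeIso.nil := by rintro ⟨⟩; rfl
      rw [Fintype.sum_eq_single TreeIso.nil fun f hf => absurd (this f) hf,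
        Fintype.sum_eq_single TreeIso.nil fun f hf => absurd (this f) hf, pow_one]
    · have h1 : ∀ t : BinaryTree Unit, t ≠ nil → 2 ≤ t.numLeaves := by
        rintro (_ | ⟨b, l, r⟩) ht
        · exact absurd rfl ht
        · have := l.numLeaves_pos
          have := r.numLeaves_pos
          simp only [BinaryTree.numLeaves]
          omega
      have := l.numLeaves_pos
      have := r.numLeaves_pos
      rcases not_and_or.1 h' with hn | hn
      · have := h1 l hn
        omega
      · have := h1 r hn
        omega
    · rename_i h'
      obtain ⟨rfl, rfl⟩ := h'
      exact absurd rfl h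
    · simp

/-- The sum of the generating polynomials of all trees with `n` internal nodes. -/
noncomputable def cherrySum (n : ℕ) : Polynomial ℤ :=
  ∑ t ∈ BinaryTree.treesOfNumNodesEq n, cherryPoly t

theorem coeff_cherrySum (n j : ℕ) : (cherrySum n).coeff j = numCherryAut (n + 1) j := by
  rw [cherrySum, ← sum_planeTree, Polynomial.finsetSum_coeff, numCherryAut, Nat.cast_sum]
  exact Finset.sum_congr rfl fun t _ => coeff_cherryPoly _ _

theorem cherrySum_zero : cherrySum 0 = 1 := by
  rw [cherrySum, BinaryTree.treesOfNumNodesEq_zero, Finset.sum_singleton, cherryPoly_nil]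

/-- The Catalan convolution, with a correction from the only tree that has one internal vertex. -/
theorem cherrySum_succ (n : ℕ) : cherrySum (n + 1) =
    (∑ ij ∈ Finset.HasAntidiagonal.antidiagonal n, cherrySum ij.1 * cherrySum ij.2) +
      if n = 0 then Polynomial.X else 0 := by
  have h : ∀ ij ∈ Finset.HasAntidiagonal.antidiagonal n, ∑ t ∈ BinaryTree.pairwiseNode
      (BinaryTree.treesOfNumNodesEq ij.1) (BinaryTree.treesOfNumNodesEq ij.2), cherryPoly t =
      cherrySum ij.1 * cherrySum ij.2 + if n = 0 then Polynomial.X else 0 := by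
    rintro ⟨i, j⟩ hij
    rw [Finset.HasAntidiagonal.mem_antidiagonal] at hij
    rw [Finset.sum_map, Finset.sum_product]
    change ∑ s ∈ _, ∑ t ∈ _, cherryPoly (node () s t) = _
    simp only [cherryPoly_node, Finset.sum_add_distrib]
    congr 1
    · rw [cherrySum, cherrySum, Finset.sum_mul_sum]
    · split_ifs with h0
      · obtain ⟨rfl, rfl⟩ : i = 0 ∧ j = 0 := by omega
        simp
      · refine Finset.sum_eq_zero fun s hs => Finset.sum_eq_zero fun t ht => if_neg ?_
        rintro ⟨rfl, rfl⟩
        rw [BinaryTree.mem_treesOfNumNodesEq] at hs ht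
        simp only [BinaryTree.numNodes] at hs ht
        omega
  rw [cherrySum, BinaryTree.treesOfNumNodesEq_succ, Finset.sum_biUnion, Finset.sum_congr rfl h,
    Finset.sum_add_distrib]
  · congr 1
    split_ifs with h0
    · subst h0
      simp
    · simp
  · simp_rw [Set.PairwiseDisjoint, Set.Pairwise, Finset.disjoint_left]
    aesop

section PowerSeries

open PowerSeries

/-- A quadratic equation determines a power series. -/
theorem eq_of_quadratic {R : Type*} [CommRing R] {p F G : R⟦X⟧} (hF : F = p + X * F ^ 2)
    (hG : G = p + X * G ^ 2) : F = G := by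
  ext n
  induction n using Nat.strong_induction_on with
  | _ n ih =>
    rw [hF, hG, map_add, map_add, add_right_inj]
    rcases n with _ | n
    · simp
    -- The factor `X` lowers the degree, so only coefficients covered by the induction hypothesis
    -- occur.
    · rw [coeff_succ_X_mul, coeff_succ_X_mul, pow_two, pow_two, coeff_mul, coeff_mul]
      refine Finset.sum_congr rfl fun ij hij => ?_
      rw [Finset.HasAntidiagonal.mem_antidiagonal] at hij
      rw [ih _ (by omega), ih _ (by omega)]

theorem coeff_one_add_C_mul_X_pow {R : Type*} [CommRing R] (u : R) (d m : ℕ) :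
    coeff m ((1 + C u * X : R⟦X⟧) ^ d) = d.choose m * u ^ m := by
  have h1 : (1 + C u * X : R⟦X⟧) = rescale u (1 + X) := by simp [rescale_X]
  have h2 : ((1 + X : R⟦X⟧)) ^ d = ((1 + Polynomial.X : Polynomial R) ^ d : Polynomial R) := by simp
  rw [h1, ← map_pow, coeff_rescale, h2, Polynomial.coeff_coe, Polynomial.coeff_one_add_X_pow,
    mul_comm]

/-- The Catalan generating function at `x * (1 + u * x)`. -/
noncomputable def catalanSubst {R : Type*} [CommRing R] (u : R) : R⟦X⟧ :=
  (PowerSeries.map (Nat.castRingHom R) catalanSeries).subst (X * (1 + C u * X) : R⟦X⟧)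

theorem hasSubst_mul {R : Type*} [CommRing R] (u : R) : HasSubst (X * (1 + C u * X) : R⟦X⟧) :=
  HasSubst.of_constantCoeff_zero' (by simp)

theorem catalanSubst_eq {R : Type*} [CommRing R] (u : R) :
    catalanSubst u = 1 + X * (1 + C u * X) * catalanSubst u ^ 2 := by
  have h := congrArg (PowerSeries.map (Nat.castRingHom R)) catalanSeries_sq_mul_X_add_one
  rw [map_add, map_mul, map_pow, map_one, PowerSeries.map_X] at h
  have h2 := congrArg (substAlgHom (hasSubst_mul u)) h
  rw [map_add, map_mul, map_pow, map_one, substAlgHom_X, coe_substAlgHom] at h2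
  change catalanSubst u ^ 2 * _ + 1 = catalanSubst u at h2
  linear_combination -h2

theorem coeff_catalanSubst {R : Type*} [CommRing R] (u : R) (n : ℕ) : coeff n (catalanSubst u) =
    ∑ d ∈ Finset.range (n + 1), catalan d * (d.choose (n - d) * u ^ (n - d)) := by
  have h : ∀ d, coeff n ((X * (1 + C u * X) : R⟦X⟧) ^ d) =
      if d ≤ n then d.choose (n - d) * u ^ (n - d) else 0 := by
    intro d
    rw [mul_pow, coeff_X_pow_mul', coeff_one_add_C_mul_X_pow]
  rw [catalanSubst, coeff_subst' (hasSubst_mul u), finsum_eq_sum_of_support_subset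
    (s := Finset.range (n + 1))]
  · refine Finset.sum_congr rfl fun d hd => ?_
    rw [h, if_pos (Nat.lt_succ_iff.1 (Finset.mem_range.1 hd))]
    simp
  · intro d hd
    by_contra hd'
    rw [Finset.mem_coe, Finset.mem_range, Nat.lt_succ_iff] at hd'
    exact hd (by simp only [h, if_neg hd', smul_zero])

/-- Put `q = 1 + u * X`. The generating function satisfies `F = q + X * F ^ 2`, and so does `q`
times the Catalan series at `X * q`, as multiplying `catalanSubst_eq` by `q` shows. -/
theorem cherrySum_eq_coeff (n : ℕ) : cherrySum n =
    coeff n ((1 + C (Polynomial.X : Polynomial ℤ) * X) * catalanSubst Polynomial.X) := by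
  have hF : mk cherrySum = (1 + C (Polynomial.X : Polynomial ℤ) * X) + X * mk cherrySum ^ 2 := by
    ext1 n
    rcases n with _ | n
    · simp [cherrySum_zero]
    · rw [coeff_mk, cherrySum_succ, map_add, coeff_succ_X_mul, pow_two, coeff_mul, add_comm]
      congr 1
      · rw [map_add, coeff_one, if_neg n.succ_ne_zero, zero_add, coeff_succ_mul_X, coeff_C]
      · simp only [coeff_mk]
  have hG := catalanSubst_eq (Polynomial.X : Polynomial ℤ)
  rw [← eq_of_quadratic hF (G := (1 + C Polynomial.X * X) * catalanSubst Polynomial.X)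
    (by linear_combination (1 + C Polynomial.X * X) * hG), coeff_mk]

end PowerSeries

theorem coeff_sum_catalan (n j : ℕ) :
    (∑ d ∈ Finset.range (n + 1), (catalan d : Polynomial ℤ) *
      (d.choose (n - d) * (Polynomial.X : Polynomial ℤ) ^ (n - d))).coeff j =
      if j ≤ n then (catalan (n - j) * (n - j).choose j : ℤ) else 0 := by
  have h : ∀ d, ((catalan d : Polynomial ℤ) *
      (d.choose (n - d) * (Polynomial.X : Polynomial ℤ) ^ (n - d))).coeff j =
      if j = n - d then (catalan d * d.choose (n - d) : ℤ) else 0 := by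
    intro d
    rw [← mul_assoc, ← Nat.cast_mul, Polynomial.coeff_natCast_mul, Polynomial.coeff_X_pow]
    split_ifs <;> simp
  rw [Polynomial.finsetSum_coeff, Finset.sum_congr rfl fun d _ => h d]
  split_ifs with hj
  · rw [Finset.sum_eq_single_of_mem (n - j) (Finset.mem_range.2 (by omega))]
    · rw [if_pos (by omega), show n - (n - j) = j by omega]
    · intro d hd hne
      rw [Finset.mem_range] at hd
      exact if_neg (by omega)
  · exact Finset.sum_eq_zero fun d _ => if_neg (by omega)

/-- The two terms of the factor `1 + u * X` give `(n - j).choose j` and `(n - j).choose (j - 1)`,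
both times `catalan (n - j)`; Pascal's rule adds them. -/
theorem numCherryAut_eq {n j : ℕ} (hj : j ≤ n) :
    numCherryAut (n + 1) j = catalan (n - j) * (n + 1 - j).choose j := by
  have h : ((numCherryAut (n + 1) j : ℕ) : ℤ) = _ := (coeff_cherrySum n j).symm
  rw [cherrySum_eq_coeff, add_mul, one_mul, map_add, mul_assoc, PowerSeries.coeff_C_mul,
    Polynomial.coeff_add, coeff_catalanSubst, coeff_sum_catalan, if_pos hj] at h
  rcases n with _ | n
  · obtain rfl : j = 0 := by omega
    simpa using h
  rw [PowerSeries.coeff_succ_X_mul, coeff_catalanSubst] at h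
  rcases j with _ | j
  · simpa using h
  rw [Polynomial.coeff_X_mul, coeff_sum_catalan, if_pos (by omega)] at h
  rw [show n + 1 + 1 - (j + 1) = (n - j) + 1 by omega, Nat.choose_succ_succ']
  rw [show n + 1 - (j + 1) = n - j by omega] at h ⊢
  zify
  linear_combination h

/-! ### Limits of the factorial moments -/

open Filter Topology

theorem tendsto_catalan_ratio (j : ℕ) :
    Tendsto (fun m : ℕ => (catalan m : ℝ) / catalan (m + j)) atTop (𝓝 ((1 / 4) ^ j)) := by
  have hpos : ∀ m, (0 : ℝ) < catalan m := fun m => by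
    have h := succ_mul_catalan_eq_centralBinom m
    have := m.centralBinom_pos
    have : 0 < catalan m := Nat.pos_of_ne_zero fun h0 => by rw [h0] at h; omega
    exact_mod_cast this
  have h1 : Tendsto (fun m : ℕ => (catalan m : ℝ) / catalan (m + 1)) atTop (𝓝 (1 / 4)) := by
    -- The ratio is `(m + 2) / (2 * (2 * m + 1))`.
    have h2 : ∀ m : ℕ, (catalan m : ℝ) / catalan (m + 1) = 1 / 4 + 3 / 4 / (2 * m + 1) := by
      intro m
      have e1 : ((m : ℝ) + 1) * catalan m = m.centralBinom := by
        exact_mod_cast succ_mul_catalan_eq_centralBinom m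
      have e2 : ((m : ℝ) + 1 + 1) * catalan (m + 1) = (m + 1).centralBinom := by
        exact_mod_cast succ_mul_catalan_eq_centralBinom (m + 1)
      have e3 : ((m : ℝ) + 1) * (m + 1).centralBinom = 2 * (2 * m + 1) * m.centralBinom := by
        exact_mod_cast m.succ_mul_centralBinom_succ
      have hm : (0 : ℝ) < (m : ℝ) + 1 := by positivity
      have h3 : ((m : ℝ) + 1 + 1) * catalan (m + 1) = 2 * (2 * m + 1) * catalan m := by
        refine mul_left_cancel₀ hm.ne' ?_
        rw [e2, e3, ← e1]
        ring
      rw [div_eq_iff (hpos _).ne']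
      have h4 : (0 : ℝ) < 2 * m + 1 := by positivity
      field_simp
      linarith
    simp_rw [h2]
    have h5 : Tendsto (fun m : ℕ => (3 / 4 : ℝ) / (2 * m + 1)) atTop (𝓝 0) := by
      refine Tendsto.div_atTop tendsto_const_nhds ?_
      exact tendsto_atTop_add_const_right _ _
        (tendsto_natCast_atTop_atTop.const_mul_atTop (by norm_num))
    simpa using h5.const_add (1 / 4 : ℝ)
  induction j with
  | zero => exact tendsto_const_nhds.congr fun m => by simp [(hpos m).ne']
  | succ j ih =>
    have h2 := ih.mul (h1.comp (tendsto_add_atTop_nat j))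
    rw [← pow_succ] at h2
    refine h2.congr fun m => ?_
    simp only [Function.comp]
    rw [div_mul_div_cancel₀ (hpos _).ne', add_assoc]

/-- The normalized factorial moments of the number of matched cherries. -/
noncomputable def moment (n j : ℕ) : ℝ :=
  numCherryAut n j ^ 2 * ((n - 2 * j).factorial * 2 ^ j * j.factorial) / Fintype.card (Rep n)

theorem moment_nonneg (n j : ℕ) : 0 ≤ moment n j := by unfold moment; positivity

theorem moment_le_pow (n j : ℕ) : moment n j ≤ expBase ^ j / j.factorial := by
  have := expBase_pos
  refine div_le_of_le_mul₀ (by positivity) (by positivity) ?_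
  rw [card_rep, mul_comm (_ / _)]
  exact_mod_cast moment_le n j

theorem card_rep_succ (n : ℕ) :
    Fintype.card (Rep (n + 1)) = catalan n ^ 2 * (n + 1).factorial := by
  rw [card_rep, card_planeTree]

/-- The squared Catalan ratio tends to `16 ^ (-j)`, and the squared binomial over the falling
factorial of order `2 * j` to `1 / j! ^ 2`. With the factor `2 ^ j * j!` this gives `(1 / 8) ^ j /
j!`. -/
theorem tendsto_moment (j : ℕ) :
    Tendsto (fun n => moment n j) atTop (𝓝 ((1 / 8) ^ j / j.factorial)) := by
  -- With `n = m + (j + 1)` the count becomes `catalan m * (m + 1).choose j`, free of truncated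
  -- subtraction.
  rw [← tendsto_add_atTop_iff_nat (j + 1)]
  have hA := tendsto_catalan_ratio j
  have hB : Tendsto (fun m : ℕ => ((m + 1).choose j : ℝ) / (((m + 1 : ℕ) : ℝ) ^ j / j.factorial))
      atTop (𝓝 1) := by
    refine ((Asymptotics.isEquivalent_iff_tendsto_one ?_).1 (isEquivalent_choose j)).comp
      (tendsto_add_atTop_nat 1)
    filter_upwards [eventually_gt_atTop 0] with n hn
    positivity
  have hR : Tendsto (fun m : ℕ => ((m + 1 : ℕ) : ℝ) / ((m + (j + 1) : ℕ) : ℝ)) atTop (𝓝 1) := by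
    have h : ∀ m : ℕ, ((m + 1 : ℕ) : ℝ) / ((m + (j + 1) : ℕ) : ℝ) =
        1 - j / ((m + (j + 1) : ℕ) : ℝ) := by
      intro m
      have : ((m + (j + 1) : ℕ) : ℝ) ≠ 0 := by positivity
      field_simp
      push_cast
      ring
    simp_rw [h]
    have h2 : Tendsto (fun m : ℕ => (j : ℝ) / ((m + (j + 1) : ℕ) : ℝ)) atTop (𝓝 0) :=
      (tendsto_const_div_atTop_nhds_zero_nat (j : ℝ)).comp (tendsto_add_atTop_nat (j + 1))
    simpa using h2.const_sub 1
  have hD : Tendsto (fun m : ℕ => ((m + (j + 1)).descFactorial (2 * j) : ℝ) /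
      ((m + (j + 1) : ℕ) : ℝ) ^ (2 * j)) atTop (𝓝 1) := by
    refine ((Asymptotics.isEquivalent_iff_tendsto_one ?_).1
      (isEquivalent_descFactorial (2 * j))).comp (tendsto_add_atTop_nat (j + 1))
    filter_upwards [eventually_gt_atTop 0] with n hn
    positivity
  have h := ((((hA.pow 2).mul (hB.pow 2)).mul (hR.pow (2 * j))).mul (hD.inv₀ one_ne_zero)).mul_const
    ((2 : ℝ) ^ j / j.factorial)
  have hlim : ((1 / 4 : ℝ) ^ j) ^ 2 * 1 ^ 2 * 1 ^ (2 * j) * 1⁻¹ * (2 ^ j / j.factorial) =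
      (1 / 8) ^ j / j.factorial := by
    rw [one_pow, one_pow, inv_one, mul_one, mul_one, mul_one, ← pow_mul, mul_comm j 2, pow_mul,
      mul_div_assoc', ← mul_pow]
    norm_num
  rw [hlim] at h
  refine h.congr' ?_
  filter_upwards [eventually_ge_atTop j] with m hm
  have e1 : numCherryAut (m + (j + 1)) j = catalan m * (m + 1).choose j := by
    have := numCherryAut_eq (n := m + j) (j := j) (by omega)
    rw [show m + j - j = m by omega, show m + j + 1 - j = m + 1 by omega] at this
    exact this
  have e2 : ((m + (j + 1) - 2 * j).factorial : ℝ) * (m + (j + 1)).descFactorial (2 * j) =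
      (m + (j + 1)).factorial := by
    exact_mod_cast Nat.factorial_mul_descFactorial (show 2 * j ≤ m + (j + 1) by omega)
  have e3 : Fintype.card (Rep (m + (j + 1))) = catalan (m + j) ^ 2 * (m + (j + 1)).factorial :=
    card_rep_succ (m + j)
  have hf : ((m + (j + 1) - 2 * j).factorial : ℝ) ≠ 0 := by positivity
  have hd : ((m + (j + 1)).descFactorial (2 * j) : ℝ) ≠ 0 := by
    rintro h0
    rw [h0, mul_zero] at e2
    exact absurd e2.symm (by positivity)
  rw [moment, e1, e3]
  push_cast [← e2]
  have hm1 : (m : ℝ) + 1 ≠ 0 := by positivity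
  have hm2 : (m : ℝ) + (j + 1) ≠ 0 := by positivity
  have hj : (j.factorial : ℝ) ≠ 0 := by positivity
  simp only [div_pow, inv_div, mul_pow]
  rw [← pow_mul, mul_comm j 2]
  field_simp

/-! ### From factorial moments to the Poisson limit for representatives -/

theorem sum_choose_eq (n j : ℕ) :
    moment n j = (∑ X : Rep n, X.numMatchedCherries.choose j : ℕ) / Fintype.card (Rep n) := by
  rw [sum_choose_numMatchedCherries, moment]
  push_cast
  rfl

/-- Otherwise the moment of order `X.numMatchedCherries` would vanish although `X` contributes `1`
to it. The crude bound suffices to make the binomial expansions finite. -/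
theorem numMatchedCherries_le {n : ℕ} (X : Rep n) : X.numMatchedCherries ≤ n := by
  by_contra! h
  have h1 := sum_choose_numMatchedCherries n X.numMatchedCherries
  rw [numCherryAut_eq_zero (by omega), zero_pow two_ne_zero, zero_mul, Finset.sum_eq_zero_iff] at h1
  simpa using h1 X (Finset.mem_univ _)

/-- Convergence of averages of combinations of binomial coefficients of the number of
matched cherries. -/
theorem tendsto_average {c g : ℕ → ℝ} (hc : ∀ j, |c j| ≤ 2 ^ j)
    (hg : ∀ m n, m ≤ n → ∑ j ∈ Finset.range (n + 1), c j * m.choose j = g m) {L : ℝ}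
    (hL : HasSum (fun j => c j * ((1 / 8) ^ j / j.factorial)) L) :
    Tendsto (fun n => (∑ X : Rep n, g X.numMatchedCherries) / Fintype.card (Rep n)) atTop (𝓝 L) := by
  have hB := expBase_pos
  have h1 : ∀ n, (∑ X : Rep n, g X.numMatchedCherries) / Fintype.card (Rep n) =
      ∑' j, c j * moment n j := by
    intro n
    rw [tsum_eq_sum (s := Finset.range (n + 1))]
    · simp_rw [sum_choose_eq, mul_div_assoc', ← Finset.sum_div, Nat.cast_sum, Finset.mul_sum]
      rw [Finset.sum_comm]
      congr 1
      exact Finset.sum_congr rfl fun X _ => (hg _ _ (numMatchedCherries_le X)).symm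
    · intro j hj
      rw [Finset.mem_range] at hj
      rw [moment, numCherryAut_eq_zero (by omega)]
      simp
  simp_rw [h1]
  rw [← hL.tsum_eq]
  refine tendsto_tsum_of_dominated_convergence
    (bound := fun j => (2 * expBase) ^ j / j.factorial) (Real.summable_pow_div_factorial _)
    (fun j => (tendsto_moment j).const_mul _) (Eventually.of_forall fun n j => ?_)
  rw [norm_mul, Real.norm_eq_abs, Real.norm_of_nonneg (moment_nonneg n j), mul_pow, mul_div_assoc]
  exact mul_le_mul (hc j) (moment_le_pow n j) (moment_nonneg n j) (by positivity)

theorem sum_range_choose_of_le {c : ℕ → ℝ} {m n : ℕ} (h : m ≤ n) :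
    ∑ j ∈ Finset.range (n + 1), c j * m.choose j = ∑ j ∈ Finset.range (m + 1), c j * m.choose j := by
  symm
  refine Finset.sum_subset (Finset.range_mono (by omega)) fun j _ hj => ?_
  rw [Finset.mem_range] at hj
  rw [Nat.choose_eq_zero_of_lt (by omega), Nat.cast_zero, mul_zero]

theorem hasSum_exp (x : ℝ) : HasSum (fun j : ℕ => x ^ j / j.factorial) (Real.exp x) := by
  rw [Real.exp_eq_exp_ℝ]
  exact NormedSpace.expSeries_div_hasSum_exp x

theorem tendsto_two_pow :
    Tendsto (fun n => (∑ X : Rep n, (2 : ℝ) ^ X.numMatchedCherries) / Fintype.card (Rep n)) atTop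
      (𝓝 (Real.exp (1 / 8))) := by
  refine tendsto_average (c := fun _ => 1) (g := fun m => 2 ^ m) (fun j => ?_) (fun m n h => ?_) ?_
  · rw [abs_one]
    exact one_le_pow₀ one_le_two
  · rw [sum_range_choose_of_le h]
    simp only [one_mul]
    exact_mod_cast m.sum_range_choose
  · simpa using hasSum_exp (1 / 8)

/-- Binomial inversion: the indicator of `m = k` as a combination of the `m.choose j`. The identity
`h3` factors out `(k + i).choose k` and leaves an alternating row sum. -/
theorem alternating_sum_choose (m k : ℕ) :
    ∑ j ∈ Finset.range (m + 1), ((-1) ^ (j + k) * j.choose k : ℝ) * m.choose j =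
      if m = k then 1 else 0 := by
  rcases lt_or_ge m k with h | h
  · rw [if_neg h.ne]
    refine Finset.sum_eq_zero fun j hj => ?_
    rw [Finset.mem_range] at hj
    rw [Nat.choose_eq_zero_of_lt (show j < k by omega), Nat.cast_zero, mul_zero, zero_mul]
  · obtain ⟨i, rfl⟩ := Nat.exists_eq_add_of_le h
    have h1 := Int.alternating_sum_range_choose (n := i)
    rw [add_assoc, Finset.sum_range_add, Finset.sum_eq_zero, zero_add]
    · have h2 : ∀ x ∈ Finset.range (i + 1), ((-1) ^ (k + x + k) * (k + x).choose k : ℝ) *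
          (k + i).choose (k + x) = (k + i).choose k * ((-1) ^ x * i.choose x) := by
        intro x _
        have h3 := Nat.choose_mul (n := k + i) (k := k + x) (s := k) (by omega)
        rw [Nat.add_sub_cancel_left, Nat.add_sub_cancel_left] at h3
        have h4 : ((k + i).choose (k + x) : ℝ) * (k + x).choose k =
          (k + i).choose k * i.choose x := by exact_mod_cast h3
        rw [show k + x + k = x + 2 * k by omega, pow_add, pow_mul, neg_one_sq, one_pow, mul_one]
        linear_combination (-1) ^ x * h4
      rw [Finset.sum_congr rfl h2, ← Finset.mul_sum]
      have h5 : ∑ x ∈ Finset.range (i + 1), ((-1) ^ x * i.choose x : ℝ) = if i = 0 then 1 else 0 := by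
        exact_mod_cast h1
      rw [h5]
      rcases i.eq_zero_or_pos with rfl | hi
      · simp
      · rw [if_neg hi.ne', if_neg (by omega), mul_zero]
    · intro j hj
      rw [Finset.mem_range] at hj
      rw [Nat.choose_eq_zero_of_lt hj, Nat.cast_zero, mul_zero, zero_mul]

/-- The number of matched cherries of a random representative converges to a Poisson
distribution. -/
theorem tendsto_indicator (k : ℕ) :
    Tendsto (fun n => (∑ X : Rep n, if X.numMatchedCherries = k then (1 : ℝ) else 0) /
      Fintype.card (Rep n)) atTop (𝓝 ((1 / 8) ^ k / k.factorial * Real.exp (-1 / 8))) := by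
  refine tendsto_average (c := fun j => (-1) ^ (j + k) * j.choose k)
    (g := fun m => if m = k then 1 else 0) (fun j => ?_) (fun m n h => ?_) ?_
  · rw [abs_mul, abs_pow, abs_neg, abs_one, one_pow, one_mul, Nat.abs_cast]
    exact_mod_cast Nat.choose_le_two_pow j k
  · rw [sum_range_choose_of_le h, alternating_sum_choose]
  -- The terms with `j < k` vanish; with `j = k + i` the rest is the exponential series at `-1 / 8`.
  · rw [← (add_right_injective k).hasSum_iff]
    · have h0 := (hasSum_exp (-1 / 8)).mul_left ((1 / 8 : ℝ) ^ k / k.factorial)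
      refine Eq.mpr (congrArg (fun F : ℕ → ℝ => HasSum F _) (funext fun i => ?_)) h0
      have h : ((k + i).choose k * k.factorial * i.factorial : ℝ) = (k + i).factorial := by
        rw [Nat.choose_symm_add]
        exact_mod_cast Nat.add_choose_mul_factorial_mul_factorial k i
      have hk : (k.factorial : ℝ) ≠ 0 := by positivity
      have hi : (i.factorial : ℝ) ≠ 0 := by positivity
      have hc : ((k + i).choose k : ℝ) ≠ 0 := by
        exact_mod_cast (Nat.choose_pos (Nat.le_add_right k i)).ne'
      simp only [Function.comp]
      rw [← h, show k + i + k = i + 2 * k by omega, pow_add, pow_mul, neg_one_sq, one_pow, mul_one,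
        neg_div, neg_pow (1 / 8 : ℝ) i, pow_add]
      field_simp
    · intro j hj
      rw [Nat.choose_eq_zero_of_lt, Nat.cast_zero, mul_zero, zero_mul]
      by_contra! h
      exact hj ⟨j - k, by simp; omega⟩

/-! ### Transfer to tanglegrams -/

section Final

variable {n : ℕ}

/-- The total number of automorphisms of the representatives with a given property, in relation to
the number of all representatives. -/
noncomputable def autMass (n : ℕ) (P : Rep n → Prop) : ℝ :=
  open Classical in (∑ X : Rep n, if P X then (X.numAut : ℝ) else 0) / Fintype.card (Rep n)

/-- The average number of automorphisms that are not induced by matched cherries. -/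
noncomputable def notInducedMass (n : ℕ) : ℝ :=
  (∑ X : Rep n, (Nat.card {f : Iso X X // ¬ X.IsInduced f} : ℝ)) / Fintype.card (Rep n)

theorem notInducedMass_nonneg (n : ℕ) : 0 ≤ notInducedMass n := by
  unfold notInducedMass
  positivity

theorem tendsto_notInducedMass : Tendsto notInducedMass atTop (𝓝 0) := by
  refine squeeze_zero notInducedMass_nonneg (fun n => ?_)
    (tendsto_const_div_atTop_nhds_zero_nat (2 * Real.exp (2 * expBase)))
  refine div_le_of_le_mul₀ (by positivity) (by positivity) ?_
  rw [mul_comm]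
  exact_mod_cast sum_card_not_induced_le n

theorem prob_eq (hn : 0 < n) (E : Tanglegram n → Prop) :
    prob n E = autMass n (fun X => E X.toTanglegram) / autMass n fun _ => True := by
  classical
  have hN : (Fintype.card (Rep n) : ℝ) ≠ 0 := by
    obtain ⟨m, rfl⟩ := Nat.exists_eq_add_one.2 hn
    rw [card_rep_succ]
    have h := succ_mul_catalan_eq_centralBinom m
    have := m.centralBinom_pos
    have : catalan m ≠ 0 := fun h0 => by rw [h0] at h; omega
    positivity
  have key : ∀ E : Tanglegram n → Prop, (∑ X : Rep n, if E X.toTanglegram then (X.numAut : ℝ) else 0)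
      = 4 ^ (n - 1) * Nat.card {T : Tanglegram n // E T} := by
    intro E
    have h := card_tanglegram E
    rw [Finset.sum_filter] at h
    exact_mod_cast h.symm
  have h2 : ∑ X : Rep n, (X.numAut : ℝ) = 4 ^ (n - 1) * Nat.card (Tanglegram n) := by
    rw [← Nat.card_congr (Equiv.subtypeUnivEquiv (p := fun _ => True) fun _ => trivial), ← key]
    simp
  have h3 : prob n E = (∑ X : Rep n, if E X.toTanglegram then (X.numAut : ℝ) else 0) /
      ∑ X : Rep n, (X.numAut : ℝ) := by
    rw [key, h2, mul_div_mul_left _ _ (by positivity)]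
    rfl
  unfold autMass
  rw [div_div_div_cancel_right₀ hN, h3]
  simp only [if_true]

/-- On the exceptional representatives `2 ^ M` is at most the number of automorphisms that are not
induced, so `numAut` is at most twice that number. -/
theorem autMass_le (P Q : Rep n → Prop) (h : ∀ X, P X → ¬ Q X → ¬ X.AllAutInduced) :
    autMass n P ≤ autMass n Q + 2 * notInducedMass n := by
  classical
  unfold autMass notInducedMass
  rw [mul_div_assoc', ← add_div]
  gcongr
  rw [Finset.mul_sum, ← Finset.sum_add_distrib]
  refine Finset.sum_le_sum fun X _ => ?_
  have h1 : (X.numAut : ℝ) = 2 ^ X.numMatchedCherries +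
      Nat.card {f : Iso X X // ¬ X.IsInduced f} := by exact_mod_cast X.numAut_eq_add
  by_cases hP : P X
  · by_cases hQ : Q X
    · rw [if_pos hP, if_pos hQ]
      linarith [(Nat.card {f : Iso X X // ¬ X.IsInduced f}).cast_nonneg (α := ℝ)]
    · have h2 : (2 ^ X.numMatchedCherries : ℝ) ≤ Nat.card {f : Iso X X // ¬ X.IsInduced f} := by
        exact_mod_cast Rep.card_induced_le_of_not_allAutInduced (h X hP hQ)
      rw [if_pos hP, if_neg hQ]
      linarith
  · rw [if_neg hP]
    positivity

theorem autMass_mono {P Q : Rep n → Prop} (h : ∀ X, P X → Q X) : autMass n P ≤ autMass n Q := by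
  classical
  unfold autMass
  gcongr with X
  by_cases hP : P X
  · rw [if_pos hP, if_pos (h X hP)]
  · rw [if_neg hP]
    positivity

theorem tendsto_autMass_of_subset {P Q : ∀ n, Rep n → Prop} {L : ℝ}
    (hP : Tendsto (fun n => autMass n (P n)) atTop (𝓝 L)) (hQ : ∀ n X, Q n X → P n X)
    (h : ∀ n X, P n X → ¬ Q n X → ¬ X.AllAutInduced) :
    Tendsto (fun n => autMass n (Q n)) atTop (𝓝 L) := by
  refine tendsto_of_tendsto_of_tendsto_of_le_of_le
    (by simpa using hP.sub (tendsto_notInducedMass.const_mul 2)) hP (fun n => ?_)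
    fun n => autMass_mono (hQ n)
  have := autMass_le (P n) (Q n) (h n)
  linarith

/-- Replacing `numAut` by `2 ^ M` changes the average by at most `notInducedMass`, which tends to
`0`. -/
theorem tendsto_autMass_of_average {P : ∀ n, Rep n → Prop} {p : ℕ → Prop} [DecidablePred p]
    (hp : ∀ n X, P n X ↔ p X.numMatchedCherries) {L : ℝ}
    (hL : Tendsto (fun n => (∑ X : Rep n, if p X.numMatchedCherries then
      (2 : ℝ) ^ X.numMatchedCherries else 0) / Fintype.card (Rep n)) atTop (𝓝 L)) :
    Tendsto (fun n => autMass n (P n)) atTop (𝓝 L) := by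
  classical
  refine tendsto_of_tendsto_of_tendsto_of_le_of_le hL
    (by simpa using hL.add tendsto_notInducedMass) (fun n => ?_) fun n => ?_
  · unfold autMass
    dsimp only
    gcongr with X
    rw [X.numAut_eq_add]
    by_cases h : p X.numMatchedCherries
    · rw [if_pos h, if_pos ((hp n X).2 h)]
      push_cast
      linarith [(Nat.card {f : Iso X X // ¬ X.IsInduced f}).cast_nonneg (α := ℝ)]
    · rw [if_neg h, if_neg (mt (hp n X).1 h)]
  · unfold autMass notInducedMass
    dsimp only
    rw [← add_div, ← Finset.sum_add_distrib]
    gcongr with X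
    rw [X.numAut_eq_add]
    by_cases h : p X.numMatchedCherries
    · rw [if_pos h, if_pos ((hp n X).2 h)]
      push_cast
      exact le_rfl
    · rw [if_neg h, if_neg (mt (hp n X).1 h), zero_add]
      positivity

theorem tendsto_autMass_true :
    Tendsto (fun n => autMass n fun _ => True) atTop (𝓝 (Real.exp (1 / 8))) :=
  tendsto_autMass_of_average (p := fun _ => True) (fun _ _ => Iff.rfl) (by simpa using tendsto_two_pow)

theorem tendsto_autMass_eq (k : ℕ) :
    Tendsto (fun n => autMass n fun X => X.numMatchedCherries = k) atTop
      (𝓝 (2 ^ k * ((1 / 8) ^ k / k.factorial * Real.exp (-1 / 8)))) := by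
  refine tendsto_autMass_of_average (p := fun m => m = k) (fun _ _ => Iff.rfl)
    (((tendsto_indicator k).const_mul (2 ^ k)).congr fun n => ?_)
  rw [mul_div_assoc', Finset.mul_sum]
  congr 1
  refine Finset.sum_congr rfl fun X _ => ?_
  split_ifs with h
  · rw [h, mul_one]
  · rw [mul_zero]

theorem tendsto_prob {E : ∀ n, Tanglegram n → Prop} {L : ℝ}
    (h : Tendsto (fun n => autMass n fun X => E n X.toTanglegram) atTop (𝓝 L)) :
    Tendsto (fun n => prob n (E n)) atTop (𝓝 (L / Real.exp (1 / 8))) := by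
  refine (h.div tendsto_autMass_true (Real.exp_pos _).ne').congr' ?_
  filter_upwards [eventually_gt_atTop 0] with n hn
  exact (prob_eq hn _).symm

theorem poisson_limit (k : ℕ) :
    2 ^ k * ((1 / 8) ^ k / k.factorial * Real.exp (-1 / 8)) / Real.exp (1 / 8) =
      Real.exp (-1 / 4) / (4 ^ k * (k.factorial : ℝ)) := by
  have h1 : Real.exp (-1 / 4) * Real.exp (1 / 8) = Real.exp (-1 / 8) := by
    rw [← Real.exp_add]
    norm_num
  have h2 : (8 : ℝ) ^ k = 2 ^ k * 4 ^ k := by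
    rw [← mul_pow]
    norm_num
  rw [← h1, one_div_pow, h2]
  field_simp

end Final

end RandomTanglegram

theorem theorem2 :
    (∀ k : ℕ, Filter.Tendsto
      (fun n : ℕ => RandomTanglegram.prob n fun T => T.numMatchedCherries = k)
      Filter.atTop (nhds (Real.exp (-1 / 4) / (4 ^ k * (k.factorial : ℝ))))) ∧
    (∀ k : ℕ, Filter.Tendsto
      (fun n : ℕ => RandomTanglegram.prob n fun T =>
        T.numMatchedCherries = k ∧ T.numAut = 2 ^ k ∧ T.AllAutInduced)
      Filter.atTop (nhds (Real.exp (-1 / 4) / (4 ^ k * (k.factorial : ℝ))))) ∧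
    Filter.Tendsto (fun n : ℕ => RandomTanglegram.prob n fun T => T.AllAutInduced)
      Filter.atTop (nhds 1) := by
  refine ⟨fun k => ?_, fun k => ?_, ?_⟩
  · rw [← RandomTanglegram.poisson_limit]
    exact RandomTanglegram.tendsto_prob (RandomTanglegram.tendsto_autMass_eq k)
  · rw [← RandomTanglegram.poisson_limit]
    refine RandomTanglegram.tendsto_prob (E := fun n T =>
      T.numMatchedCherries = k ∧ T.numAut = 2 ^ k ∧ T.AllAutInduced)
      (RandomTanglegram.tendsto_autMass_of_subset (RandomTanglegram.tendsto_autMass_eq k)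
        (fun n X h => h.1) fun n X h h' hX => h' ⟨h, ?_, hX⟩)
    -- If all automorphisms are induced, their number is forced, so the middle condition of the
    -- event removes nothing further.
    change X.numAut = 2 ^ k
    rw [X.numAut_eq_add, (RandomTanglegram.Rep.allAutInduced_iff X).1 hX, h, add_zero]
  · rw [← div_self (Real.exp_pos (1 / 8)).ne']
    exact RandomTanglegram.tendsto_prob (E := fun n T => T.AllAutInduced)
      (RandomTanglegram.tendsto_autMass_of_subset RandomTanglegram.tendsto_autMass_true
        (fun _ _ _ => trivial) fun n X _ h => h)
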